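/- For a Borel probability measure $\mu$ on $\mathbb{C}$ with compact support, let $I(\mu)=\iint -\log|z-w|\,d\mu(z)\,d\mu(w)\in(-\infty,+\infty]$ be its logarithmic energy, and for $E\subset\mathbb{C}$ let $\mathrm{Cap}(E)=\exp(-\inf_\mu I(\mu))$ be the logarithmic capacity, where the infimum is over all Borel probability measures $\mu$ whose support is a compact subset of $E$ (with $\inf\emptyset=+\infty$ and $e^{-\infty}=0$). **Theorem (Random phase transition).** Let $(c_k)$ be i.i.d. real random variables whose common distribution is absolutely continuous on $[0,1]$, with a density that is bounded and positive Lebesgue-almost everywhere on $[0,1]$. Let $\lambda>0$ and $\alpha>0$, let $I_k$ be the open interval with center $c_k$ and length $l_k=e^{-\lambda k^\alpha}$, and let $$S=\bigcap_{m}\bigcup_{k\ge m} I_k .$$ 1. If $0<\alpha\le 1$, then almost surely $\mathrm{Cap}(S)=\mathrm{Cap}([0,1])$, and $\mathrm{Cap}([0,1])>0$. 2. If $\alpha>1$, then $\mathrm{Cap}(S)=0$ (for every realization of the centers). -/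

import Mathlib

open MeasureTheory ProbabilityTheory Set
open scoped ENNReal

noncomputable section

/-- The logarithmic kernel `-log |z - w|`, with the value `+∞` on the diagonal. -/
def logKernel (z w : ℂ) : EReal :=
  -ENNReal.log (edist z w)

/-- The logarithmic energy `I(μ) = ∬ -log |z - w| dμ(z) dμ(w)`, as the integral of the positive
part of the kernel minus the integral of its negative part. For a finite measure with compact
support the second integral is finite, so that the difference is a well-defined element of
`(-∞, +∞]`. -/
def logEnergy (μ : Measure ℂ) : EReal :=
  ((∫⁻ w, ∫⁻ z, (logKernel z w).toENNReal ∂μ ∂μ : ℝ≥0∞) : EReal) -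
    ((∫⁻ w, ∫⁻ z, (-logKernel z w).toENNReal ∂μ ∂μ : ℝ≥0∞) : EReal)

/-- The logarithmic capacity `exp (-inf I(μ))`, the infimum being over the Borel probability
measures whose support is a compact subset of `E`; `exp (-∞) = 0`. -/
def logCapacity (E : Set ℂ) : ℝ≥0∞ :=
  EReal.exp (-sInf {e : EReal | ∃ μ : Measure ℂ, IsProbabilityMeasure μ ∧
    IsCompact μ.support ∧ μ.support ⊆ E ∧ e = logEnergy μ})

/-- The set `⋂ m, ⋃ k ≥ m, I k`, where `I k` is the open interval with center `c k` and
length `l k`. -/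
def limsupIntervals (c l : ℕ → ℝ) : Set ℝ :=
  ⋂ m : ℕ, ⋃ k ≥ m, Ioo (c k - l k / 2) (c k + l k / 2)

/-- The lengths `l_k = exp (-Λ k ^ α)`. -/
def expLength (Λ α : ℝ) (k : ℕ) : ℝ :=
  Real.exp (-Λ * (k : ℝ) ^ α)

end

/-! ### The kernel and the energy on the real line -/

section
open Filter Topology

/-! For `1 < α`, suppose a measure carried by the limsup set has finite energy. Its potential `p` is
then finite almost everywhere. If an interval `I k` meets `{p ≤ M}`, then `Λ * k ^ α` times its mass
is at most `M`, because the kernel is at least `Λ * k ^ α` inside it. These masses are summable, so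
by Borel–Cantelli almost every point of `{p ≤ M}` lies in finitely many intervals. This contradicts
the choice of the measure (`logCapacity_limsup_eq_zero`).

For `α ≤ 1`, fix a threshold `t` above the energy of some probability measure on `[0, 1]`. Smoothing
over fine dyadic cells and rounding replaces the measure by a step density `h` from a countable
family, with `densityEnergy h < t * (∫ h) ^ 2` (`exists_stepDensity_of_realEnergy_lt`). This
inequality is invariant under scaling, so nothing has to be normalized before the end.

The main step moves `h` into intervals of large index. Over a finite block `s` of indices, put mass
`g (c k) / (k + 1)` uniformly on a dyadic cell around `c k` that fits inside `I k`, where the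
integer `g` is close to a multiple of `h / f` and `f` is the density of the centers. The mean
density is then at most a multiple of `h`. With `w` the harmonic weight of `s`, independence bounds
the off-diagonal part of the expected energy by `w ^ 2` times the energy of that multiple. Cell `k`
has generation of order `k`, hence self-energy `O(k)`, so the diagonal part is `O(∑ (k + 1) / (k +
1) ^ 2) = O(w)`. As the harmonic series diverges, the diagonal part becomes negligible. A second
moment argument gives each heavy block a fixed positive probability of keeping the energy inequality
(`exists_measure_blockEvent_ge`). Disjoint blocks are independent, and the second Borel–Cantelli
lemma makes infinitely many succeed (`ae_exists_block`).

By countability this holds almost surely for all step densities and all rational thresholds at once.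
Iterating gives nested compact supports whose intersection lies in the limsup set. A weak limit of
the normalized measures lives there with energy at most `t` (`exists_measure_of_antitone`). -/

theorem continuous_logKernel : Continuous fun p : ℂ × ℂ => logKernel p.1 p.2 := by
  unfold logKernel
  exact (ENNReal.continuous_log.comp (continuous_fst.edist continuous_snd)).neg

/-- The positive part of the logarithmic kernel, on the real line. -/
noncomputable def realKernel (x y : ℝ) : ℝ≥0∞ := (logKernel (x : ℂ) (y : ℂ)).toENNReal

theorem continuous_realKernel : Continuous fun p : ℝ × ℝ => realKernel p.1 p.2 := by
  have h : Continuous fun p : ℝ × ℝ => ((p.1 : ℂ), (p.2 : ℂ)) := by fun_prop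
  exact (continuous_logKernel.comp h).ereal_toENNReal

theorem measurable_realKernel : Measurable fun p : ℝ × ℝ => realKernel p.1 p.2 :=
  continuous_realKernel.measurable

theorem measurable_realKernel_comp {γ : Type*} [MeasurableSpace γ] {a b : γ → ℝ}
    (ha : Measurable a) (hb : Measurable b) : Measurable fun t => realKernel (a t) (b t) := by
  have h : Measurable fun t => (a t, b t) := ha.prodMk hb
  have h2 := Measurable.comp measurable_realKernel h
  simp only [Function.comp_def] at h2
  exact h2

theorem realKernel_self (x : ℝ) : realKernel x x = ⊤ := by
  simp [realKernel, logKernel]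

theorem realKernel_of_ne {x y : ℝ} (h : x ≠ y) :
    realKernel x y = ENNReal.ofReal (-Real.log |x - y|) := by
  have h1 : edist (x : ℂ) (y : ℂ) = ENNReal.ofReal |x - y| := by
    rw [edist_dist, Complex.dist_eq, ← Complex.ofReal_sub, Complex.norm_real, Real.norm_eq_abs]
  have h2 : 0 < |x - y| := abs_pos.2 (sub_ne_zero.2 h)
  rw [realKernel, logKernel, h1, ENNReal.log_ofReal_of_pos h2, ← EReal.coe_neg,
    EReal.real_coe_toENNReal]

theorem logKernel_nonneg_of_edist_le_one {z w : ℂ} (h : edist z w ≤ 1) : 0 ≤ logKernel z w := by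
  have : ENNReal.log (edist z w) ≤ 0 := by simpa using h
  rw [logKernel]
  exact EReal.neg_nonneg.2 this

theorem edist_ofReal_le_one {x y : ℝ} (hx : x ∈ Icc (0 : ℝ) 1) (hy : y ∈ Icc (0 : ℝ) 1) :
    edist (x : ℂ) (y : ℂ) ≤ 1 := by
  have h1 : edist (x : ℂ) (y : ℂ) = ENNReal.ofReal |x - y| := by
    rw [edist_dist, Complex.dist_eq, ← Complex.ofReal_sub, Complex.norm_real, Real.norm_eq_abs]
  rw [h1]
  refine ENNReal.ofReal_le_one.2 (abs_le.2 ⟨?_, ?_⟩) <;> linarith [hx.1, hx.2, hy.1, hy.2]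

/-- The energy of a measure on the real line with respect to `realKernel`. -/
noncomputable def realEnergy (μ : Measure ℝ) : ℝ≥0∞ := ∫⁻ y, ∫⁻ x, realKernel x y ∂μ ∂μ

/-- For a measure carried by `[0, 1]` the kernel is nonnegative, and the logarithmic energy is
the `realEnergy`. -/
theorem logEnergy_map_ofReal (μ : Measure ℝ) [SFinite μ] (hμ : ∀ᵐ x ∂μ, x ∈ Icc (0 : ℝ) 1) :
    logEnergy (μ.map ((↑) : ℝ → ℂ)) = (realEnergy μ : EReal) := by
  have hm : Measurable ((↑) : ℝ → ℂ) := Complex.measurable_ofReal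
  have hk : Measurable fun p : ℂ × ℂ => (logKernel p.1 p.2).toENNReal :=
    continuous_logKernel.ereal_toENNReal.measurable
  have hk' : Measurable fun p : ℂ × ℂ => (-logKernel p.1 p.2).toENNReal :=
    continuous_logKernel.neg.ereal_toENNReal.measurable
  have key : ∀ F : ℂ → ℂ → ℝ≥0∞, Measurable (fun p : ℂ × ℂ => F p.1 p.2) →
      ∫⁻ w, ∫⁻ z, F z w ∂(μ.map ((↑) : ℝ → ℂ)) ∂(μ.map ((↑) : ℝ → ℂ)) =
        ∫⁻ y, ∫⁻ x, F (x : ℂ) (y : ℂ) ∂μ ∂μ := by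
    intro F hF
    rw [lintegral_map (Measurable.lintegral_prod_left hF) hm]
    refine lintegral_congr fun y => ?_
    have hF' : Measurable fun z : ℂ => F z (y : ℂ) :=
      hF.comp (by fun_prop : Measurable fun z : ℂ => (z, (y : ℂ)))
    exact lintegral_map hF' hm
  have h0 : ∫⁻ y, ∫⁻ x, (-logKernel (x : ℂ) (y : ℂ)).toENNReal ∂μ ∂μ = 0 := by
    refine lintegral_eq_zero_of_ae_eq_zero ?_
    filter_upwards [hμ] with y hy
    refine lintegral_eq_zero_of_ae_eq_zero ?_
    filter_upwards [hμ] with x hx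
    refine EReal.toENNReal_of_nonpos ?_
    have := logKernel_nonneg_of_edist_le_one (edist_ofReal_le_one hx hy)
    simpa using this
  rw [logEnergy, key _ hk, key _ hk', h0]
  simp [realEnergy, realKernel]

/-- Any measure carried by the image of `[0, 1]` comes from the real line. -/
theorem map_ofReal_map_re (μ : Measure ℂ)
    (hμ : ∀ᵐ z ∂μ, z ∈ ((↑) : ℝ → ℂ) '' Icc (0 : ℝ) 1) :
    (μ.map Complex.re).map ((↑) : ℝ → ℂ) = μ ∧ ∀ᵐ x ∂(μ.map Complex.re), x ∈ Icc (0 : ℝ) 1 := by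
  constructor
  · rw [Measure.map_map Complex.measurable_ofReal Complex.measurable_re]
    conv_rhs => rw [← Measure.map_id (μ := μ)]
    refine Measure.map_congr ?_
    filter_upwards [hμ] with z hz
    obtain ⟨x, -, rfl⟩ := hz
    simp
  · refine (ae_map_iff Complex.measurable_re.aemeasurable (p := fun x => x ∈ Icc (0 : ℝ) 1)
      measurableSet_Icc).2 ?_
    filter_upwards [hμ] with z hz
    obtain ⟨x, hx, rfl⟩ := hz
    simpa using hx

/-! ### Sets of vanishing capacity -/

theorem logCapacity_mono {E F : Set ℂ} (h : E ⊆ F) : logCapacity E ≤ logCapacity F := by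
  unfold logCapacity
  rw [EReal.exp_le_exp_iff, EReal.neg_le_neg_iff]
  refine sInf_le_sInf ?_
  rintro e ⟨μ, h1, h2, h3, h4⟩
  exact ⟨μ, h1, h2, h3.trans h, h4⟩

/-- On a compact support the negative part of the kernel is bounded by the logarithm of the
diameter. Its integral is therefore finite and cannot compensate an infinite positive part. -/
theorem lintegral_logKernel_ne_top_of_logEnergy_ne_top (μ : Measure ℂ) [IsFiniteMeasure μ]
    (hc : IsCompact μ.support) (he : logEnergy μ ≠ ⊤) :
    ∫⁻ w, ∫⁻ z, (logKernel z w).toENNReal ∂μ ∂μ ≠ ⊤ := by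
  have hneg : ∫⁻ w, ∫⁻ z, (-logKernel z w).toENNReal ∂μ ∂μ ≠ ⊤ := by
    obtain ⟨C, hC⟩ : ∃ C : ℝ≥0∞, C ≠ ⊤ ∧
        ∀ z ∈ μ.support, ∀ w ∈ μ.support, (-logKernel z w).toENNReal ≤ C := by
      refine ⟨(ENNReal.log (Metric.ediam μ.support)).toENNReal, ?_, ?_⟩
      · rw [EReal.toENNReal_ne_top_iff, Ne, ENNReal.log_eq_top_iff]
        exact hc.isBounded.ediam_ne_top
      · intro z hz w hw
        refine EReal.toENNReal_le_toENNReal ?_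
        rw [logKernel, neg_neg]
        exact ENNReal.log_le_log (Metric.edist_le_ediam_of_mem hz hw)
    have hs : ∀ᵐ z ∂μ, z ∈ μ.support := Measure.support_mem_ae
    refine ne_top_of_le_ne_top (b := ∫⁻ w, ∫⁻ z, C ∂μ ∂μ) ?_ ?_
    · simp only [lintegral_const]
      exact ENNReal.mul_ne_top (ENNReal.mul_ne_top hC.1 (measure_ne_top _ _)) (measure_ne_top _ _)
    · refine lintegral_mono_ae ?_
      filter_upwards [hs] with w hw
      refine lintegral_mono_ae ?_
      filter_upwards [hs] with z hz using hC.2 z hz w hw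
  intro h
  apply he
  rw [logEnergy, h]
  lift (∫⁻ w, ∫⁻ z, (-logKernel z w).toENNReal ∂μ ∂μ) to NNReal using hneg with b
  rw [EReal.coe_ennreal_top, sub_eq_add_neg]
  refine EReal.top_add_of_ne_bot ?_
  rw [Ne, EReal.neg_eq_bot_iff]
  simp

/-- A limsup of sets `J k` whose diameters `l k` satisfy `∑ 1 / log (1 / l k) < ∞` has
capacity zero. -/
theorem logCapacity_limsup_eq_zero (J : ℕ → Set ℂ) (d : ℕ → ℝ≥0∞)
    (hd : ∀ k, ∀ z ∈ J k, ∀ w ∈ J k, d k ≤ (logKernel z w).toENNReal)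
    (hJ : ∀ k, MeasurableSet (J k))
    (hsum : ∑' k, (d k)⁻¹ ≠ ⊤) (E : Set ℂ) (hE : E ⊆ ⋂ m : ℕ, ⋃ k ≥ m, J k) :
    logCapacity E = 0 := by
  rw [logCapacity, EReal.exp_eq_zero_iff, EReal.neg_eq_bot_iff, sInf_eq_top]
  rintro e ⟨μ, hμ, hc, hs, rfl⟩
  by_contra he
  have hfin := lintegral_logKernel_ne_top_of_logEnergy_ne_top μ hc he
  set p : ℂ → ℝ≥0∞ := fun w => ∫⁻ z, (logKernel z w).toENNReal ∂μ with hp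
  have hpm : Measurable p :=
    Measurable.lintegral_prod_left (continuous_logKernel.ereal_toENNReal.measurable)
  have hae : ∀ᵐ w ∂μ, p w < ⊤ := ae_lt_top hpm hfin
  -- The levels `{p ≤ M}` exhaust almost all of the space, and Borel–Cantelli is applied on each.
  have hlim : ∀ M : ℕ, μ {w | p w ≤ M ∧ ∃ᶠ k in atTop, w ∈ J k} = 0 := by
    intro M
    have h1 : ∀ k, μ ({w | p w ≤ M} ∩ J k) ≤ M * (d k)⁻¹ := by
      intro k
      rcases ({w | p w ≤ M} ∩ J k).eq_empty_or_nonempty with h | ⟨w, hw, hwJ⟩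
      · simp [h]
      -- A single point `w` of `J k` with small potential controls the mass of all of `J k`.
      · have h2 : d k * μ (J k) ≤ M := by
          calc d k * μ (J k) = ∫⁻ z in J k, d k ∂μ := by simp
            _ ≤ ∫⁻ z in J k, (logKernel z w).toENNReal ∂μ :=
              setLIntegral_mono' (hJ k) fun z hz => hd k z hz w hwJ
            _ ≤ p w := setLIntegral_le_lintegral _ _
            _ ≤ M := hw
        refine (measure_mono inter_subset_right).trans ?_
        rw [← div_eq_mul_inv]
        by_cases hd0 : d k = 0
        · exfalso
          refine hsum (ENNReal.tsum_eq_top_of_eq_top ⟨k, by simp [hd0]⟩)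
        · rw [ENNReal.le_div_iff_mul_le (Or.inl hd0) (Or.inr (ENNReal.natCast_ne_top M)), mul_comm]
          exact h2
    have h3 : ∑' k, μ ({w | p w ≤ M} ∩ J k) ≠ ⊤ := by
      refine ne_top_of_le_ne_top ?_ (ENNReal.tsum_le_tsum h1)
      rw [ENNReal.tsum_mul_left]
      exact ENNReal.mul_ne_top (ENNReal.natCast_ne_top M) hsum
    have h4 := measure_setOfPred_frequently_eq_zero (μ := μ)
      (p := fun k w => w ∈ {w | p w ≤ M} ∩ J k) h3
    refine measure_mono_null ?_ h4
    rintro w ⟨hw, hf⟩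
    exact hf.mono fun k hk => ⟨hw, hk⟩
  have hall : ∀ᵐ w ∂μ, ∀ M : ℕ, ¬ (p w ≤ M ∧ ∃ᶠ k in atTop, w ∈ J k) :=
    ae_all_iff.2 fun M => by
      rw [ae_iff]; simpa only [not_not] using hlim M
  have hsupp : ∀ᵐ w ∂μ, w ∈ μ.support := Measure.support_mem_ae
  have hfalse : ∀ᵐ w ∂μ, False := by
    filter_upwards [hae, hall, hsupp] with w h1 h2 h3
    obtain ⟨M, hM⟩ := ENNReal.exists_nat_gt h1.ne
    refine h2 M ⟨hM.le, frequently_atTop.2 fun m => ?_⟩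
    have := mem_iInter.1 (hE (hs h3)) m
    simpa using this
  simp [NeZero.ne μ] at hfalse

/-! ### Dyadic cells -/

/-- The density, as a function of `x`, of the uniform distribution on the dyadic cell of
generation `m` that contains `s`. -/
noncomputable def cellDensity (m : ℕ) (s x : ℝ) : ℝ≥0∞ :=
  if ⌊(2 : ℝ) ^ m * s⌋ = ⌊(2 : ℝ) ^ m * x⌋ then 2 ^ m else 0

theorem cellDensity_comm (m : ℕ) (s x : ℝ) : cellDensity m s x = cellDensity m x s := by
  simp [cellDensity, eq_comm]

theorem measurable_cellDensity (m : ℕ) : Measurable fun p : ℝ × ℝ => cellDensity m p.1 p.2 := by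
  unfold cellDensity
  refine Measurable.ite ?_ measurable_const measurable_const
  exact measurableSet_eq_fun (Int.measurable_floor.comp (measurable_fst.const_mul _))
    (Int.measurable_floor.comp (measurable_snd.const_mul _))

theorem measurable_cellDensity_comp {γ : Type*} [MeasurableSpace γ] (m : ℕ) {a b : γ → ℝ}
    (ha : Measurable a) (hb : Measurable b) : Measurable fun t => cellDensity m (a t) (b t) := by
  have h : Measurable fun t => (a t, b t) := ha.prodMk hb
  have h2 := Measurable.comp (measurable_cellDensity m) h
  simp only [Function.comp_def] at h2
  exact h2

/-- If `s` and `x` share a cell, that cell can be named by either. In the diagonal terms this frees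
one factor from the random center. -/
theorem cellDensity_mul_cellDensity (m : ℕ) (s x y : ℝ) :
    cellDensity m s x * cellDensity m s y = cellDensity m s x * cellDensity m x y := by
  unfold cellDensity
  split_ifs <;> simp_all

theorem floor_eq_iff_mem_Ico (m : ℕ) (i : ℤ) (x : ℝ) :
    ⌊(2 : ℝ) ^ m * x⌋ = i ↔ x ∈ Ico ((i : ℝ) / 2 ^ m) ((i + 1 : ℝ) / 2 ^ m) := by
  have h : (0 : ℝ) < 2 ^ m := by positivity
  rw [Int.floor_eq_iff, mem_Ico, div_le_iff₀ h, lt_div_iff₀ h, mul_comm x]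

theorem setOf_floor_eq (m : ℕ) (i : ℤ) :
    {x : ℝ | ⌊(2 : ℝ) ^ m * x⌋ = i} = Ico ((i : ℝ) / 2 ^ m) ((i + 1 : ℝ) / 2 ^ m) := by
  ext x; exact floor_eq_iff_mem_Ico m i x

theorem volume_setOf_floor_eq (m : ℕ) (i : ℤ) :
    volume {x : ℝ | ⌊(2 : ℝ) ^ m * x⌋ = i} = ((2 : ℝ≥0∞) ^ m)⁻¹ := by
  have h : (0 : ℝ) < 2 ^ m := by positivity
  rw [setOf_floor_eq, Real.volume_Ico, ← sub_div, add_sub_cancel_left, one_div,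
    ENNReal.ofReal_inv_of_pos h, ENNReal.ofReal_pow (by norm_num)]
  simp

theorem measurableSet_setOf_floor_eq (m : ℕ) (i : ℤ) :
    MeasurableSet {x : ℝ | ⌊(2 : ℝ) ^ m * x⌋ = i} := by
  rw [setOf_floor_eq]; exact measurableSet_Ico

theorem cellDensity_eq_indicator (m : ℕ) (s : ℝ) :
    cellDensity m s =
      {x : ℝ | ⌊(2 : ℝ) ^ m * x⌋ = ⌊(2 : ℝ) ^ m * s⌋}.indicator fun _ => 2 ^ m := by
  ext x
  simp [cellDensity, indicator, eq_comm]

theorem lintegral_cellDensity_mul (m : ℕ) (s : ℝ) (μ : Measure ℝ) (F : ℝ → ℝ≥0∞) :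
    ∫⁻ x, cellDensity m s x * F x ∂μ =
      2 ^ m * ∫⁻ x in {x : ℝ | ⌊(2 : ℝ) ^ m * x⌋ = ⌊(2 : ℝ) ^ m * s⌋}, F x ∂μ := by
  have h : (fun x => cellDensity m s x * F x) =
      {x : ℝ | ⌊(2 : ℝ) ^ m * x⌋ = ⌊(2 : ℝ) ^ m * s⌋}.indicator fun x => 2 ^ m * F x := by
    ext x
    rw [cellDensity_eq_indicator]
    by_cases hx : x ∈ {x : ℝ | ⌊(2 : ℝ) ^ m * x⌋ = ⌊(2 : ℝ) ^ m * s⌋} <;> simp [hx]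
  rw [h, lintegral_indicator (measurableSet_setOf_floor_eq m _),
    lintegral_const_mul' _ _ (by finiteness)]

theorem two_pow_mul_inv_cancel (m : ℕ) : (2 : ℝ≥0∞) ^ m * ((2 : ℝ≥0∞) ^ m)⁻¹ = 1 :=
  ENNReal.mul_inv_cancel (by simp) (by finiteness)

theorem lintegral_cellDensity (m : ℕ) (s : ℝ) : ∫⁻ x, cellDensity m s x = 1 := by
  have h := lintegral_cellDensity_mul m s volume 1
  simp only [Pi.one_apply, mul_one] at h
  rw [h, setLIntegral_one, volume_setOf_floor_eq, two_pow_mul_inv_cancel]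

theorem abs_sub_lt_of_floor_eq {m : ℕ} {s x : ℝ} (h : ⌊(2 : ℝ) ^ m * s⌋ = ⌊(2 : ℝ) ^ m * x⌋) :
    |s - x| < (1 / 2) ^ m := by
  have h1 := Int.abs_sub_lt_one_of_floor_eq_floor h
  have h2 : (0 : ℝ) < 2 ^ m := by positivity
  rw [← mul_sub, abs_mul, abs_of_pos h2] at h1
  rw [one_div, inv_pow, ← one_div, lt_div_iff₀ h2, mul_comm]
  exact h1

theorem cellDensity_ne_zero {m : ℕ} {s x : ℝ} (h : cellDensity m s x ≠ 0) :
    ⌊(2 : ℝ) ^ m * s⌋ = ⌊(2 : ℝ) ^ m * x⌋ := by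
  by_contra h1
  exact h (if_neg h1)

/-! ### Averages of the kernel over a cell -/

/-- `Real.log` is even, so the constant is twice the integral of `-log` over `[0, 1]`. -/
theorem lintegral_ofReal_neg_log_le : ∫⁻ t : ℝ, ENNReal.ofReal (-Real.log t) ≤ 2 := by
  have h0 : ∀ t : ℝ, t ∉ Ioc (-1 : ℝ) 1 → ENNReal.ofReal (-Real.log t) = 0 := by
    intro t ht
    refine ENNReal.ofReal_of_nonpos ?_
    rw [neg_nonpos, ← Real.log_abs]
    refine Real.log_nonneg ?_
    by_contra h
    rw [not_le, abs_lt] at h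
    exact ht ⟨h.1, h.2.le⟩
  have h1 : ∫⁻ t : ℝ, ENNReal.ofReal (-Real.log t) =
      ∫⁻ t in Ioc (-1 : ℝ) 1, ENNReal.ofReal (-Real.log t) := by
    rw [← lintegral_indicator measurableSet_Ioc]
    refine lintegral_congr fun t => ?_
    by_cases ht : t ∈ Ioc (-1 : ℝ) 1
    · simp [ht]
    · rw [indicator_of_notMem ht, h0 t ht]
  have hint : IntervalIntegrable (fun t => -Real.log t) volume (-1) 1 :=
    intervalIntegral.intervalIntegrable_log'.neg
  rw [h1, ← ofReal_integral_eq_lintegral_ofReal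
    ((intervalIntegrable_iff_integrableOn_Ioc_of_le (by norm_num)).1 hint),
    ← intervalIntegral.integral_of_le (by norm_num), intervalIntegral.integral_neg, integral_log]
  · norm_num
  · refine (ae_restrict_iff' measurableSet_Ioc).2 (Eventually.of_forall fun t ht => ?_)
    show (0 : ℝ) ≤ -Real.log t
    rw [neg_nonneg, ← Real.log_abs]
    exact Real.log_nonpos (abs_nonneg t) (abs_le.2 ⟨ht.1.le, ht.2⟩)

/-- Rescaling by `2 ^ m` splits the kernel into the constant `m * log 2` and `-log |2 ^ m * (x -
y)|`. The positive part of the latter, multiplied by `2 ^ m`, has integral at most `2` over the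
whole line, so `x` need not lie in the cell. -/
theorem lintegral_cellDensity_mul_realKernel_le (m : ℕ) (z x : ℝ) :
    ∫⁻ y, cellDensity m z y * realKernel x y ≤ ENNReal.ofReal (m * Real.log 2) + 2 := by
  have h2 : (0 : ℝ) < 2 ^ m := by positivity
  have hL : Measurable fun t : ℝ => ENNReal.ofReal (-Real.log t) := by fun_prop
  have hE : Measurable fun y => cellDensity m z y :=
    measurable_cellDensity_comp m measurable_const measurable_id
  have hae : ∀ᵐ y : ℝ, x ≠ y := by
    have : ∀ᵐ y : ℝ, y ≠ x := by simp [ae_iff]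
    filter_upwards [this] with y hy using hy.symm
  have hscale : ∫⁻ y : ℝ, 2 ^ m * ENNReal.ofReal (-Real.log (2 ^ m * (x - y))) ≤ 2 := by
    rw [lintegral_const_mul' _ _ (by finiteness),
      lintegral_sub_left_eq_self (fun t => ENNReal.ofReal (-Real.log (2 ^ m * t))) x,
      ← lintegral_map (μ := volume) (f := fun t => ENNReal.ofReal (-Real.log t))
        (g := fun t => 2 ^ m * t) hL (measurable_const_mul _), Real.map_volume_mul_left h2.ne',
      lintegral_smul_measure, abs_of_pos (by positivity), ENNReal.ofReal_inv_of_pos h2,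
      ENNReal.ofReal_pow (by norm_num), smul_eq_mul, ← mul_assoc]
    simp only [ENNReal.ofReal_ofNat]
    rw [two_pow_mul_inv_cancel, one_mul]
    exact lintegral_ofReal_neg_log_le
  calc ∫⁻ y, cellDensity m z y * realKernel x y
      ≤ ∫⁻ y, (cellDensity m z y * ENNReal.ofReal (m * Real.log 2) +
          2 ^ m * ENNReal.ofReal (-Real.log (2 ^ m * (x - y)))) := by
        refine lintegral_mono_ae ?_
        filter_upwards [hae] with y hy
        have h3 : -Real.log |x - y| = m * Real.log 2 + -Real.log (2 ^ m * (x - y)) := by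
          rw [Real.log_mul h2.ne' (sub_ne_zero.2 hy), Real.log_pow, Real.log_abs]; ring
        rw [realKernel_of_ne hy, h3]
        refine (mul_le_mul_right ENNReal.ofReal_add_le _).trans ?_
        rw [mul_add]
        gcongr
        unfold cellDensity
        split_ifs <;> simp
    _ ≤ ENNReal.ofReal (m * Real.log 2) + 2 := by
        rw [lintegral_add_left (hE.mul_const _), lintegral_mul_const _ hE, lintegral_cellDensity,
          one_mul]
        gcongr

/-! ### Rational dyadic step densities -/

/-- The function equal to `a / (b + 1)` on the `i`-th dyadic cell of generation `m`. -/
noncomputable def cellStep (q : ℕ × ℕ × ℕ × ℕ) (x : ℝ) : ℝ≥0∞ :=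
  if ⌊(2 : ℝ) ^ q.2.2.1 * x⌋ = (q.2.2.2 : ℤ) then (q.1 : ℝ≥0∞) / (q.2.1 + 1) else 0

/-- The densities on `[0, 1)` that are rational step functions on dyadic cells. -/
noncomputable def stepDensity : AddSubmonoid (ℝ → ℝ≥0∞) :=
  AddSubmonoid.closure (cellStep '' {q | q.2.2.2 < 2 ^ q.2.2.1})

/-- Countability is what allows one exceptional null set to serve all step densities. -/
theorem countable_stepDensity : (stepDensity : Set (ℝ → ℝ≥0∞)).Countable := by
  refine (countable_range fun l : List (ℕ × ℕ × ℕ × ℕ) => (l.map cellStep).sum).mono ?_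
  intro h hh
  obtain ⟨l, hl, rfl⟩ := AddSubmonoid.exists_list_of_mem_closure hh
  clear hh
  induction l with
  | nil => exact ⟨[], by simp⟩
  | cons u l ih =>
    obtain ⟨q, -, hq⟩ := hl u (by simp)
    obtain ⟨l', hl'⟩ := ih fun y hy => hl y (by simp [hy])
    exact ⟨q :: l', by simp only [List.map_cons, List.sum_cons, hq]; rw [← hl']⟩

theorem measurable_of_mem_stepDensity {h : ℝ → ℝ≥0∞} (hh : h ∈ stepDensity) : Measurable h := by
  induction hh using AddSubmonoid.closure_induction with
  | mem x hx =>
    obtain ⟨q, -, rfl⟩ := hx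
    exact Measurable.ite (measurableSet_setOf_floor_eq _ _) measurable_const measurable_const
  | zero => exact measurable_const
  | add x y _ _ hx hy => exact hx.add hy

theorem bounded_of_mem_stepDensity {h : ℝ → ℝ≥0∞} (hh : h ∈ stepDensity) :
    ∃ B : ℝ≥0∞, B ≠ ⊤ ∧ ∀ x, h x ≤ B := by
  induction hh using AddSubmonoid.closure_induction with
  | mem x hx =>
    obtain ⟨q, -, rfl⟩ := hx
    refine ⟨(q.1 : ℝ≥0∞) / (q.2.1 + 1), ?_, fun x => ?_⟩
    · exact ENNReal.div_ne_top (ENNReal.natCast_ne_top _) (by simp)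
    · unfold cellStep; split_ifs <;> simp
  | zero => exact ⟨0, by simp, by simp⟩
  | add x y _ _ hx hy =>
    obtain ⟨A, hA, hA'⟩ := hx
    obtain ⟨B, hB, hB'⟩ := hy
    exact ⟨A + B, by finiteness, fun t => add_le_add (hA' t) (hB' t)⟩

theorem floor_eq_of_floor_eq {r m : ℕ} (hrm : r ≤ m) {x y : ℝ}
    (h : ⌊(2 : ℝ) ^ m * x⌋ = ⌊(2 : ℝ) ^ m * y⌋) : ⌊(2 : ℝ) ^ r * x⌋ = ⌊(2 : ℝ) ^ r * y⌋ := by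
  obtain ⟨d, rfl⟩ := Nat.exists_eq_add_of_le hrm
  have key : ∀ z : ℝ, ⌊(2 : ℝ) ^ r * z⌋ = ⌊(2 : ℝ) ^ (r + d) * z⌋ / ((2 ^ d : ℕ) : ℤ) := by
    intro z
    rw [← Int.floor_div_natCast]
    congr 1
    rw [pow_add]
    push_cast
    field_simp
  rw [key, key, h]

theorem exists_const_of_mem_stepDensity {h : ℝ → ℝ≥0∞} (hh : h ∈ stepDensity) :
    ∃ r : ℕ, ∀ m ≥ r, ∀ x y : ℝ, ⌊(2 : ℝ) ^ m * x⌋ = ⌊(2 : ℝ) ^ m * y⌋ → h x = h y := by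
  induction hh using AddSubmonoid.closure_induction with
  | mem x hx =>
    obtain ⟨q, -, rfl⟩ := hx
    refine ⟨q.2.2.1, fun m hm x y hxy => ?_⟩
    simp only [cellStep, floor_eq_of_floor_eq hm hxy]
  | zero => exact ⟨0, by simp⟩
  | add u v _ _ hu hv =>
    obtain ⟨r, hr⟩ := hu
    obtain ⟨s, hs⟩ := hv
    refine ⟨max r s, fun m hm x y hxy => ?_⟩
    simp only [Pi.add_apply]
    rw [hr m (le_trans (le_max_left _ _) hm) x y hxy, hs m (le_trans (le_max_right _ _) hm) x y hxy]

theorem mem_Ico_of_mem_stepDensity {h : ℝ → ℝ≥0∞} (hh : h ∈ stepDensity) {x : ℝ} (hx : h x ≠ 0) :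
    x ∈ Ico (0 : ℝ) 1 := by
  induction hh using AddSubmonoid.closure_induction with
  | mem u hu =>
    obtain ⟨q, hq, rfl⟩ := hu
    have h1 : ⌊(2 : ℝ) ^ q.2.2.1 * x⌋ = (q.2.2.2 : ℤ) := by
      by_contra h1
      exact hx (if_neg h1)
    have h2 : (0 : ℝ) < 2 ^ q.2.2.1 := by positivity
    rw [floor_eq_iff_mem_Ico, mem_Ico, div_le_iff₀ h2, lt_div_iff₀ h2] at h1
    have h3 : ((q.2.2.2 : ℝ) + 1) ≤ 2 ^ q.2.2.1 := by exact_mod_cast hq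
    have h4 : (0 : ℝ) ≤ q.2.2.2 := by positivity
    push_cast at h1
    constructor
    · by_contra h5
      rw [not_le] at h5
      nlinarith
    · by_contra h5
      rw [not_lt] at h5
      nlinarith
  | zero => simp at hx
  | add u v _ _ hu hv =>
    by_cases h1 : u x = 0
    · refine hv fun h2 => hx ?_
      simp [h1, h2]
    · exact hu h1

theorem mul_cellDensity_mem_stepDensity (a b m : ℕ) {s : ℝ} (hs : s ∈ Ico (0 : ℝ) 1) :
    (fun x => (a : ℝ≥0∞) / (b + 1) * cellDensity m s x) ∈ stepDensity := by
  have h2 : (0 : ℝ) < 2 ^ m := by positivity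
  have h0 : 0 ≤ ⌊(2 : ℝ) ^ m * s⌋ := Int.floor_nonneg.2 (mul_nonneg h2.le hs.1)
  have h1 : ⌊(2 : ℝ) ^ m * s⌋ < 2 ^ m := by
    rw [Int.floor_lt]
    push_cast
    nlinarith [hs.2]
  obtain ⟨i, hi⟩ := Int.eq_ofNat_of_zero_le h0
  refine AddSubmonoid.subset_closure ⟨(a * 2 ^ m, b, m, i), ?_, ?_⟩
  · rw [hi] at h1
    show i < 2 ^ m
    exact_mod_cast h1
  · ext x
    simp only [cellStep, cellDensity, hi, eq_comm (a := (i : ℤ)), mul_ite, mul_zero]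
    congr 1
    push_cast
    rw [ENNReal.mul_div_right_comm]

/-- The energy of a density on the real line. -/
noncomputable def densityEnergy (u : ℝ → ℝ≥0∞) : ℝ≥0∞ :=
  ∫⁻ x, ∫⁻ y, realKernel x y * (u x * u y)

theorem densityEnergy_mono {u v : ℝ → ℝ≥0∞} (h : ∀ x, u x ≤ v x) :
    densityEnergy u ≤ densityEnergy v :=
  lintegral_mono fun x => lintegral_mono fun y => by gcongr <;> exact h _

theorem densityEnergy_const_mul (a : ℝ≥0∞) (ha : a ≠ ⊤) (u : ℝ → ℝ≥0∞) :
    densityEnergy (fun x => a * u x) = a ^ 2 * densityEnergy u := by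
  unfold densityEnergy
  rw [← lintegral_const_mul' _ _ (by finiteness)]
  refine lintegral_congr fun x => ?_
  rw [← lintegral_const_mul' _ _ (by finiteness)]
  refine lintegral_congr fun y => ?_
  ring

theorem lintegral_ne_top_of_mem_stepDensity {h : ℝ → ℝ≥0∞} (hh : h ∈ stepDensity) :
    ∫⁻ x, h x ≠ ⊤ := by
  obtain ⟨B, hB, hB'⟩ := bounded_of_mem_stepDensity hh
  have h1 : ∫⁻ x, h x ≤ ∫⁻ x in Ico (0 : ℝ) 1, B := by
    rw [← lintegral_indicator measurableSet_Ico]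
    refine lintegral_mono fun x => ?_
    by_cases hx : h x = 0
    · simp [hx]
    · simp [mem_Ico_of_mem_stepDensity hh hx, hB' x]
  refine ne_top_of_le_ne_top ?_ h1
  simp [hB]

theorem lintegral_cellDensity_mul_of_const {h : ℝ → ℝ≥0∞} {m : ℕ}
    (hm : ∀ x y : ℝ, ⌊(2 : ℝ) ^ m * x⌋ = ⌊(2 : ℝ) ^ m * y⌋ → h x = h y) (s : ℝ) :
    ∫⁻ x, cellDensity m s x * h x = h s := by
  have h1 : ∀ x, cellDensity m s x * h x = cellDensity m s x * h s := by
    intro x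
    by_cases hx : cellDensity m s x = 0
    · simp [hx]
    · rw [hm _ _ (cellDensity_ne_zero hx)]
  have hE : Measurable fun y => cellDensity m s y :=
    measurable_cellDensity_comp m measurable_const measurable_id
  simp_rw [h1]
  rw [lintegral_mul_const _ hE, lintegral_cellDensity, one_mul]

theorem densityEnergy_ne_top_of_mem_stepDensity {h : ℝ → ℝ≥0∞} (hh : h ∈ stepDensity) :
    densityEnergy h ≠ ⊤ := by
  obtain ⟨B, hB, hB'⟩ := bounded_of_mem_stepDensity hh
  have h01 : ∀ x, h x ≤ B * cellDensity 0 0 x := by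
    intro x
    by_cases hx : h x = 0
    · simp [hx]
    · have h1 := mem_Ico_of_mem_stepDensity hh hx
      have h2 : cellDensity 0 0 x = 1 := by
        have : ⌊x⌋ = 0 := Int.floor_eq_zero_iff.2 h1
        simp [cellDensity, this]
      rw [h2, mul_one]
      exact hB' x
  have hE : Measurable fun y => cellDensity 0 0 y :=
    measurable_cellDensity_comp 0 measurable_const measurable_id
  have h3 : densityEnergy h ≤ B ^ 2 * 2 := by
    refine (densityEnergy_mono h01).trans ?_
    rw [densityEnergy_const_mul _ hB]
    gcongr
    calc densityEnergy (fun x => cellDensity 0 0 x)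
        = ∫⁻ x, cellDensity 0 0 x * ∫⁻ y, cellDensity 0 0 y * realKernel x y := by
          unfold densityEnergy
          refine lintegral_congr fun x => ?_
          rw [← lintegral_const_mul' _ _ (by unfold cellDensity; split_ifs <;> simp)]
          refine lintegral_congr fun y => ?_
          ring
      _ ≤ ∫⁻ x, cellDensity 0 0 x * 2 := by
          refine lintegral_mono fun x => ?_
          gcongr
          simpa using lintegral_cellDensity_mul_realKernel_le 0 0 x
      _ = 2 := by rw [lintegral_mul_const _ hE, lintegral_cellDensity, one_mul]
  exact ne_top_of_le_ne_top (by finiteness) h3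

/-! ### Approximation of a measure by step densities -/

/-- The average of the kernel over the product of the cells of `p.1` and `p.2`. -/
noncomputable def cellAverage (r : ℕ) (p : ℝ × ℝ) : ℝ≥0∞ :=
  ∫⁻ q : ℝ × ℝ, realKernel q.1 q.2 * (cellDensity r p.1 q.1 * cellDensity r p.2 q.2)
    ∂(volume.prod volume)

theorem measurable_cellDensity_right (m : ℕ) (s : ℝ) : Measurable fun x => cellDensity m s x :=
  measurable_cellDensity_comp m measurable_const measurable_id

theorem measurable_cellDensity_left (m : ℕ) (x : ℝ) : Measurable fun s => cellDensity m s x :=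
  measurable_cellDensity_comp m measurable_id measurable_const

theorem cellDensity_ne_top (m : ℕ) (s x : ℝ) : cellDensity m s x ≠ ⊤ := by
  unfold cellDensity
  split_ifs <;> finiteness

theorem measurable_cellAverage_integrand (r : ℕ) :
    Measurable fun z : (ℝ × ℝ) × (ℝ × ℝ) =>
      realKernel z.2.1 z.2.2 * (cellDensity r z.1.1 z.2.1 * cellDensity r z.1.2 z.2.2) := by
  refine (measurable_realKernel_comp (by fun_prop) (by fun_prop)).mul
    ((measurable_cellDensity_comp r ?_ ?_).mul (measurable_cellDensity_comp r ?_ ?_)) <;> fun_prop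

theorem measurable_cellAverage (r : ℕ) : Measurable (cellAverage r) := by
  unfold cellAverage
  exact Measurable.lintegral_prod_right (measurable_cellAverage_integrand r)

theorem cellAverage_le_of_forall (r : ℕ) (p : ℝ × ℝ) (C : ℝ≥0∞)
    (h : ∀ x y : ℝ, |p.1 - x| < (1 / 2) ^ r → |p.2 - y| < (1 / 2) ^ r → realKernel x y ≤ C) :
    cellAverage r p ≤ C := by
  calc cellAverage r p
      ≤ ∫⁻ q : ℝ × ℝ, C * (cellDensity r p.1 q.1 * cellDensity r p.2 q.2)
          ∂(volume.prod volume) := by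
        refine lintegral_mono fun q => ?_
        by_cases h1 : cellDensity r p.1 q.1 = 0
        · simp [h1]
        by_cases h2 : cellDensity r p.2 q.2 = 0
        · simp [h2]
        dsimp only
        gcongr
        exact h _ _ (abs_sub_lt_of_floor_eq (cellDensity_ne_zero h1))
          (abs_sub_lt_of_floor_eq (cellDensity_ne_zero h2))
    _ = C := by
        rw [lintegral_const_mul, lintegral_prod_mul (measurable_cellDensity_right _ _).aemeasurable
          (measurable_cellDensity_right _ _).aemeasurable, lintegral_cellDensity,
          lintegral_cellDensity, mul_one, mul_one]
        exact (measurable_cellDensity_comp r measurable_const measurable_fst).mul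
          (measurable_cellDensity_comp r measurable_const measurable_snd)

theorem cellAverage_le (r : ℕ) (p : ℝ × ℝ) :
    cellAverage r p ≤ ENNReal.ofReal (r * Real.log 2) + 2 := by
  unfold cellAverage
  rw [lintegral_prod]
  · calc ∫⁻ x, ∫⁻ y, realKernel x y * (cellDensity r p.1 x * cellDensity r p.2 y)
        = ∫⁻ x, cellDensity r p.1 x * ∫⁻ y, cellDensity r p.2 y * realKernel x y := by
          refine lintegral_congr fun x => ?_
          rw [← lintegral_const_mul' _ _ (cellDensity_ne_top _ _ _)]
          refine lintegral_congr fun y => ?_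
          ring
      _ ≤ ∫⁻ x, cellDensity r p.1 x * (ENNReal.ofReal (r * Real.log 2) + 2) := by
          refine lintegral_mono fun x => ?_
          gcongr
          exact lintegral_cellDensity_mul_realKernel_le r p.2 x
      _ = _ := by
          rw [lintegral_mul_const _ (measurable_cellDensity_right _ _), lintegral_cellDensity,
            one_mul]
  · exact ((measurable_cellAverage_integrand r).comp
      (measurable_const.prodMk measurable_id)).aemeasurable

/-- For points at distance at least four cell lengths, moving inside the cells at most halves the
distance. For closer points the bound `r * log 2 + 2` of `cellAverage_le` is already comparable to
the kernel. The constant does not depend on `r`, so this is a dominating function. -/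
theorem cellAverage_le_realKernel_add (r : ℕ) (p : ℝ × ℝ) :
    cellAverage r p ≤ realKernel p.1 p.2 + 4 := by
  obtain ⟨x, y⟩ := p
  dsimp only
  rcases eq_or_ne x y with rfl | hxy
  · simp [realKernel_self]
  have hd : 0 < |x - y| := abs_pos.2 (sub_ne_zero.2 hxy)
  have hδ : (0 : ℝ) < (1 / 2) ^ r := by positivity
  have hlog2 : Real.log 2 ≤ 1 := by linarith [Real.log_two_lt_d9]
  have hlog4 : Real.log 4 = 2 * Real.log 2 := by
    rw [show (4 : ℝ) = 2 ^ 2 by norm_num, Real.log_pow]; norm_num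
  rcases le_or_gt (4 * (1 / 2) ^ r) |x - y| with h | h
  · refine cellAverage_le_of_forall r (x, y) _ fun x' y' hx hy => ?_
    dsimp only at hx hy
    have h1 : |x - y| / 2 ≤ |x' - y'| := by
      have h2 := abs_sub_le x x' y
      have h3 := abs_sub_le x' y' y
      rw [abs_sub_comm y'] at h3
      linarith
    have h2 : x' ≠ y' := by
      rintro rfl
      rw [sub_self, abs_zero] at h1
      linarith
    rw [realKernel_of_ne hxy, realKernel_of_ne h2]
    have h3 : -Real.log |x' - y'| ≤ -Real.log |x - y| + 4 := by
      have := Real.log_le_log (by positivity) h1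
      rw [Real.log_div hd.ne' (by norm_num)] at this
      linarith
    calc ENNReal.ofReal (-Real.log |x' - y'|) ≤ ENNReal.ofReal (-Real.log |x - y| + 4) :=
          ENNReal.ofReal_le_ofReal h3
      _ ≤ _ := ENNReal.ofReal_add_le.trans (by simp)
  · refine (cellAverage_le r (x, y)).trans ?_
    rw [realKernel_of_ne hxy]
    have h3 : r * Real.log 2 ≤ -Real.log |x - y| + 2 := by
      have := Real.log_le_log hd h.le
      rw [Real.log_mul (by norm_num) hδ.ne', Real.log_pow, hlog4, one_div, Real.log_inv] at this
      linarith
    calc ENNReal.ofReal (r * Real.log 2) + 2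
        ≤ (ENNReal.ofReal (-Real.log |x - y|) + 2) + 2 := by
          gcongr
          refine (ENNReal.ofReal_le_ofReal h3).trans (ENNReal.ofReal_add_le.trans ?_)
          simp
      _ = _ := by rw [add_assoc]; norm_num

/-- The cells shrink to `p` and the kernel is continuous into `[0, ∞]`. On the diagonal the bound is
trivial. -/
theorem limsup_cellAverage_le (p : ℝ × ℝ) :
    limsup (fun r => cellAverage r p) atTop ≤ realKernel p.1 p.2 := by
  refine le_of_forall_gt fun c hc => ?_
  obtain ⟨c', hc1, hc2⟩ := exists_between hc
  refine lt_of_le_of_lt (limsup_le_of_le (by isBoundedDefault) ?_) hc2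
  have h1 : {q : ℝ × ℝ | realKernel q.1 q.2 < c'} ∈ 𝓝 p :=
    continuous_realKernel.continuousAt.eventually_lt_const hc1
  obtain ⟨ε, hε, hball⟩ := Metric.mem_nhds_iff.1 h1
  have h2 : Tendsto (fun r : ℕ => ((1 : ℝ) / 2) ^ r) atTop (𝓝 0) :=
    tendsto_pow_atTop_nhds_zero_of_lt_one (by norm_num) (by norm_num)
  filter_upwards [h2.eventually_lt_const hε] with r hr
  refine cellAverage_le_of_forall r p _ fun x y hx hy => ?_
  have h3 : (x, y) ∈ Metric.ball p ε := by
    rw [Metric.mem_ball, Prod.dist_eq, max_lt_iff, dist_comm, dist_comm y, Real.dist_eq,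
      Real.dist_eq]
    exact ⟨hx.trans hr, hy.trans hr⟩
  exact (show realKernel x y < c' from hball h3).le

/-- The density obtained by spreading the mass of each dyadic cell uniformly over the cell. -/
noncomputable def cellSmoothing (r : ℕ) (μ : Measure ℝ) (x : ℝ) : ℝ≥0∞ :=
  ∫⁻ s, cellDensity r s x ∂μ

/-- Tonelli moves the smoothing from the measure to the kernel. -/
theorem densityEnergy_cellSmoothing (r : ℕ) (μ : Measure ℝ) [SFinite μ] :
    densityEnergy (cellSmoothing r μ) = ∫⁻ p, cellAverage r p ∂(μ.prod μ) := by
  have hm : Measurable (cellSmoothing r μ) :=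
    Measurable.lintegral_prod_left (measurable_cellDensity r)
  have h1 : densityEnergy (cellSmoothing r μ) = ∫⁻ q : ℝ × ℝ,
      realKernel q.1 q.2 * (cellSmoothing r μ q.1 * cellSmoothing r μ q.2)
        ∂(volume.prod volume) := by
    unfold densityEnergy
    rw [lintegral_prod]
    exact (measurable_realKernel.mul
      ((hm.comp measurable_fst).mul (hm.comp measurable_snd))).aemeasurable
  have h2 : ∀ q : ℝ × ℝ, realKernel q.1 q.2 * (cellSmoothing r μ q.1 * cellSmoothing r μ q.2) =
      ∫⁻ p : ℝ × ℝ, realKernel q.1 q.2 * (cellDensity r p.1 q.1 * cellDensity r p.2 q.2)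
        ∂(μ.prod μ) := by
    intro q
    rw [lintegral_const_mul, lintegral_prod_mul (measurable_cellDensity_left _ _).aemeasurable
      (measurable_cellDensity_left _ _).aemeasurable]
    · rfl
    · exact (measurable_cellDensity_comp r measurable_fst measurable_const).mul
        (measurable_cellDensity_comp r measurable_snd measurable_const)
  rw [h1]
  simp_rw [h2]
  rw [lintegral_lintegral_swap]
  · rfl
  · exact ((measurable_cellAverage_integrand r).comp measurable_swap).aemeasurable

theorem realEnergy_eq_lintegral_prod (μ : Measure ℝ) [SFinite μ] :
    realEnergy μ = ∫⁻ p, realKernel p.1 p.2 ∂(μ.prod μ) := by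
  rw [lintegral_prod_symm _ measurable_realKernel.aemeasurable]
  rfl

/-- Reverse Fatou lemma, dominated by the kernel plus `4`, which is integrable because the energy is
finite. -/
theorem exists_densityEnergy_cellSmoothing_lt (μ : Measure ℝ) [IsProbabilityMeasure μ]
    {t : ℝ≥0∞} (h : realEnergy μ < t) : ∃ r, densityEnergy (cellSmoothing r μ) < t := by
  have hfin : ∫⁻ p, (realKernel p.1 p.2 + 4) ∂(μ.prod μ) ≠ ⊤ := by
    rw [lintegral_add_left measurable_realKernel, ← realEnergy_eq_lintegral_prod]
    have := h.ne_top
    simp [this]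
  have h1 := limsup_lintegral_le (μ := μ.prod μ) (f := cellAverage)
    (fun p => realKernel p.1 p.2 + 4) measurable_cellAverage
    (fun r => Eventually.of_forall fun p => cellAverage_le_realKernel_add r p) hfin
  have h2 : limsup (fun r => ∫⁻ p, cellAverage r p ∂(μ.prod μ)) atTop < t := by
    refine (h1.trans (lintegral_mono fun p => limsup_cellAverage_le p)).trans_lt ?_
    rwa [← realEnergy_eq_lintegral_prod]
  obtain ⟨r, hr⟩ := (eventually_lt_of_limsup_lt h2).exists
  exact ⟨r, by rwa [densityEnergy_cellSmoothing]⟩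

theorem measure_singleton_eq_zero_of_realEnergy (μ : Measure ℝ)
    (h : realEnergy μ ≠ ⊤) (x : ℝ) : μ {x} = 0 := by
  by_contra h0
  apply h
  rw [eq_top_iff]
  calc (⊤ : ℝ≥0∞) = ∫⁻ y in {x}, ∫⁻ z in {x}, realKernel z y ∂μ ∂μ := by
        simp [realKernel_self, h0]
    _ ≤ ∫⁻ y in {x}, ∫⁻ z, realKernel z y ∂μ ∂μ :=
        lintegral_mono fun y => setLIntegral_le_lintegral _ _
    _ ≤ _ := setLIntegral_le_lintegral _ _

theorem cellSmoothing_eq (r : ℕ) (μ : Measure ℝ) (x : ℝ) :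
    cellSmoothing r μ x = 2 ^ r * μ {s : ℝ | ⌊(2 : ℝ) ^ r * s⌋ = ⌊(2 : ℝ) ^ r * x⌋} := by
  have h := lintegral_cellDensity_mul r x μ 1
  simp only [Pi.one_apply, mul_one, setLIntegral_one] at h
  rw [← h]
  exact lintegral_congr fun s => cellDensity_comm _ _ _

/-- A fine smoothing `v` has energy below `t`. Both sides of the inequality are quadratic in the
density, so the integer part of a large multiple of `v` satisfies it too. -/
theorem exists_stepDensity_of_realEnergy_lt (μ : Measure ℝ) [IsProbabilityMeasure μ]
    (hμ : ∀ᵐ x ∂μ, x ∈ Icc (0 : ℝ) 1) {t : ℝ≥0∞} (h : realEnergy μ < t) :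
    ∃ u ∈ stepDensity, densityEnergy u < t * (∫⁻ x, u x) ^ 2 := by
  obtain ⟨r, hr⟩ := exists_densityEnergy_cellSmoothing_lt μ h
  set v := cellSmoothing r μ with hv
  -- The endpoint `1` belongs to a cell outside `[0, 1)`. It has no mass, since an atom would make
  -- the energy infinite.
  have hIco : ∀ᵐ x ∂μ, x ∈ Ico (0 : ℝ) 1 := by
    have h1 : ∀ᵐ x ∂μ, x ≠ 1 := by
      simpa [ae_iff] using measure_singleton_eq_zero_of_realEnergy μ h.ne_top 1
    filter_upwards [hμ, h1] with x hx hx1 using ⟨hx.1, lt_of_le_of_ne hx.2 hx1⟩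
  have hvm : Measurable v := Measurable.lintegral_prod_left (measurable_cellDensity r)
  have hvconst : ∀ x y : ℝ, ⌊(2 : ℝ) ^ r * x⌋ = ⌊(2 : ℝ) ^ r * y⌋ → v x = v y := by
    intro x y hxy
    rw [hv, cellSmoothing_eq, cellSmoothing_eq, hxy]
  have hvtop : ∀ x, v x ≠ ⊤ := by
    intro x
    rw [hv, cellSmoothing_eq]
    finiteness
  have hv1 : ∫⁻ x in Ico (0 : ℝ) 1, v x = 1 := by
    have e1 : ∫⁻ x in Ico (0 : ℝ) 1, v x =
        ∫⁻ s, (∫⁻ x in Ico (0 : ℝ) 1, cellDensity r s x) ∂μ := by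
      rw [lintegral_lintegral_swap (measurable_cellDensity r).aemeasurable]
      rfl
    rw [e1]
    have e2 : ∀ᵐ s ∂μ, ∫⁻ x in Ico (0 : ℝ) 1, cellDensity r s x = 1 := by
      filter_upwards [hIco] with s hs
      rw [← lintegral_cellDensity r s, ← lintegral_indicator measurableSet_Ico]
      refine lintegral_congr fun x => ?_
      by_cases hx : cellDensity r s x = 0
      · simp [indicator, hx]
      · have h3 := floor_eq_of_floor_eq (Nat.zero_le r) (cellDensity_ne_zero hx)
        simp only [pow_zero, one_mul] at h3
        rw [Int.floor_eq_zero_iff.2 hs] at h3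
        rw [indicator_of_mem (Int.floor_eq_zero_iff.1 h3.symm)]
    rw [lintegral_congr_ae e2]
    simp
  -- rounding the values of a large multiple of `v` down to integers
  let u : ℕ → ℝ → ℝ≥0∞ := fun N => ∑ i ∈ Finset.range (2 ^ r),
    cellStep (⌊((N : ℝ≥0∞) * v ((i : ℝ) / 2 ^ r)).toReal⌋₊, 0, r, i)
  have hu_mem : ∀ N, u N ∈ stepDensity := fun N => sum_mem fun i hi =>
    AddSubmonoid.subset_closure ⟨_, Finset.mem_range.1 hi, rfl⟩
  have hfloor : ∀ i : ℕ, ⌊(2 : ℝ) ^ r * ((i : ℝ) / 2 ^ r)⌋ = i := by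
    intro i
    rw [mul_div_cancel₀ _ (by positivity)]
    simp
  have hu : ∀ N, ∀ x ∈ Ico (0 : ℝ) 1, u N x = ⌊((N : ℝ≥0∞) * v x).toReal⌋₊ := by
    intro N x hx
    have h2 : (0 : ℝ) < 2 ^ r := by positivity
    have h0 : 0 ≤ ⌊(2 : ℝ) ^ r * x⌋ := Int.floor_nonneg.2 (mul_nonneg h2.le hx.1)
    have h1 : ⌊(2 : ℝ) ^ r * x⌋ < 2 ^ r := by
      rw [Int.floor_lt]
      push_cast
      nlinarith [hx.2]
    obtain ⟨i, hi⟩ := Int.eq_ofNat_of_zero_le h0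
    have hi' : i < 2 ^ r := by rw [hi] at h1; exact_mod_cast h1
    simp only [u, Finset.sum_apply]
    rw [Finset.sum_eq_single i]
    · rw [cellStep, if_pos hi, hvconst _ x (by rw [hfloor, hi])]
      simp
    · intro j _ hj
      rw [cellStep, if_neg]
      rw [hi]
      exact_mod_cast hj.symm
    · intro h; exact absurd (Finset.mem_range.2 hi') h
  have hu_le : ∀ N x, u N x ≤ N * v x := by
    intro N x
    by_cases hx : u N x = 0
    · simp [hx]
    rw [hu N x (mem_Ico_of_mem_stepDensity (hu_mem N) hx), ← ENNReal.ofReal_natCast]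
    refine (ENNReal.ofReal_le_ofReal (Nat.floor_le ENNReal.toReal_nonneg)).trans ?_
    exact ENNReal.ofReal_toReal_le
  have hu_mass : ∀ N : ℕ, (N : ℝ≥0∞) ≤ ∫⁻ x, u (N + 1) x := by
    intro N
    have h1 : ∀ x ∈ Ico (0 : ℝ) 1, (N + 1 : ℝ≥0∞) * v x ≤ u (N + 1) x + 1 := by
      intro x hx
      rw [hu _ x hx]
      have h2 : ((N + 1 : ℕ) : ℝ≥0∞) * v x ≠ ⊤ :=
        ENNReal.mul_ne_top (ENNReal.natCast_ne_top _) (hvtop x)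
      rw [show (N + 1 : ℝ≥0∞) = ((N + 1 : ℕ) : ℝ≥0∞) by push_cast; rfl]
      conv_lhs => rw [← ENNReal.ofReal_toReal h2]
      refine (ENNReal.ofReal_le_ofReal (Nat.lt_floor_add_one _).le).trans ?_
      rw [ENNReal.ofReal_add (by positivity) (by norm_num)]
      simp
    have h3 : (N + 1 : ℝ≥0∞) ≤ (∫⁻ x, u (N + 1) x) + 1 := by
      calc (N + 1 : ℝ≥0∞) = ∫⁻ x in Ico (0 : ℝ) 1, (N + 1 : ℝ≥0∞) * v x := by
            rw [lintegral_const_mul _ hvm, hv1, mul_one]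
        _ ≤ ∫⁻ x in Ico (0 : ℝ) 1, (u (N + 1) x + 1) := setLIntegral_mono' measurableSet_Ico h1
        _ = (∫⁻ x in Ico (0 : ℝ) 1, u (N + 1) x) + 1 := by
            rw [lintegral_add_right _ measurable_const]; simp
        _ ≤ _ := by gcongr; exact Measure.restrict_le_self
    exact (ENNReal.add_le_add_iff_right ENNReal.one_ne_top).1 h3
  -- The density `u (N + 1)` is at most `(N + 1) * v` but has mass at least `N`. The squared ratio
  -- of these factors is the loss due to rounding.
  have hlim : Tendsto (fun N : ℕ => (1 + (N : ℝ≥0∞)⁻¹) ^ 2 * densityEnergy v) atTop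
      (𝓝 ((1 + 0) ^ 2 * densityEnergy v)) := by
    refine ENNReal.Tendsto.mul_const ?_ (Or.inl (by simp))
    exact ENNReal.Tendsto.pow (tendsto_const_nhds.add ENNReal.tendsto_inv_nat_nhds_zero)
  rw [add_zero, one_pow, one_mul] at hlim
  obtain ⟨N, hN, hN0⟩ := ((hlim.eventually_lt_const hr).and (eventually_gt_atTop 0)).exists
  refine ⟨u (N + 1), hu_mem _, ?_⟩
  have hN1 : (N : ℝ≥0∞) ≠ 0 := by exact_mod_cast hN0.ne'
  calc densityEnergy (u (N + 1)) ≤ ((N + 1 : ℕ) : ℝ≥0∞) ^ 2 * densityEnergy v := by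
        rw [← densityEnergy_const_mul _ (ENNReal.natCast_ne_top _)]
        exact densityEnergy_mono (hu_le _)
    _ = ((1 + (N : ℝ≥0∞)⁻¹) ^ 2 * densityEnergy v) * (N : ℝ≥0∞) ^ 2 := by
        have : ((N + 1 : ℕ) : ℝ≥0∞) = (1 + (N : ℝ≥0∞)⁻¹) * N := by
          rw [add_mul, ENNReal.inv_mul_cancel hN1 (ENNReal.natCast_ne_top _)]
          push_cast; ring
        rw [this]; ring
    _ < t * (N : ℝ≥0∞) ^ 2 := by
        refine ENNReal.mul_lt_mul_left ?_ (by finiteness) hN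
        simpa using hN0.ne'
    _ ≤ _ := by gcongr; exact hu_mass N

/-! ### Lower bounds for the capacity -/

theorem exp_neg_realEnergy_le_logCapacity (μ : Measure ℝ) [IsProbabilityMeasure μ] {E K : Set ℝ}
    (hK : IsCompact K) (hK1 : K ⊆ Icc 0 1) (hKE : K ⊆ E) (hμ : ∀ᵐ x ∂μ, x ∈ K) :
    EReal.exp (-(realEnergy μ : EReal)) ≤ logCapacity (((↑) : ℝ → ℂ) '' E) := by
  have hm : Measurable ((↑) : ℝ → ℂ) := Complex.measurable_ofReal
  have hKc : IsCompact (((↑) : ℝ → ℂ) '' K) := hK.image Complex.continuous_ofReal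
  have hsupp : (μ.map ((↑) : ℝ → ℂ)).support ⊆ ((↑) : ℝ → ℂ) '' K := by
    refine Measure.support_subset_of_isClosed hKc.isClosed ?_
    refine (ae_map_iff hm.aemeasurable (p := fun z => z ∈ ((↑) : ℝ → ℂ) '' K)
      hKc.isClosed.measurableSet).2 ?_
    filter_upwards [hμ] with x hx using mem_image_of_mem _ hx
  rw [logCapacity, EReal.exp_le_exp_iff, EReal.neg_le_neg_iff]
  refine sInf_le ⟨μ.map ((↑) : ℝ → ℂ), Measure.isProbabilityMeasure_map hm.aemeasurable,
    hKc.of_isClosed_subset Measure.isClosed_support hsupp, hsupp.trans (image_mono hKE), ?_⟩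
  rw [logEnergy_map_ofReal μ (hμ.mono fun x hx => hK1 hx)]

/-- To bound the capacity of `[0, 1]` from above it suffices to consider measures on the line. -/
theorem logCapacity_Icc_le {b : ℝ≥0∞}
    (h : ∀ μ : Measure ℝ, IsProbabilityMeasure μ → (∀ᵐ x ∂μ, x ∈ Icc (0 : ℝ) 1) →
      ∀ q : ℚ, realEnergy μ < ENNReal.ofReal q →
        EReal.exp (-((ENNReal.ofReal q : ℝ≥0∞) : EReal)) ≤ b) :
    logCapacity (((↑) : ℝ → ℂ) '' Icc (0 : ℝ) 1) ≤ b := by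
  rw [logCapacity, ← ENNReal.exp_log b, EReal.exp_le_exp_iff, EReal.neg_le]
  refine le_sInf ?_
  rintro e ⟨μ, hμ, -, hs, rfl⟩
  have hae : ∀ᵐ z ∂μ, z ∈ ((↑) : ℝ → ℂ) '' Icc (0 : ℝ) 1 := by
    filter_upwards [Measure.support_mem_ae (μ := μ)] with z hz using hs hz
  obtain ⟨h1, h2⟩ := map_ofReal_map_re μ hae
  have : IsProbabilityMeasure (μ.map Complex.re) :=
    Measure.isProbabilityMeasure_map Complex.measurable_re.aemeasurable
  rw [← h1, logEnergy_map_ofReal _ h2]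
  refine le_of_forall_gt fun c hc => ?_
  -- Rational thresholds keep the number of almost sure statements countable.
  obtain ⟨q, hq1, hq2⟩ := EReal.lt_iff_exists_rat_btwn.1 hc
  have hq0 : (0 : ℝ) ≤ q := by
    have := (EReal.coe_ennreal_nonneg (realEnergy (μ.map Complex.re))).trans hq1.le
    exact_mod_cast this
  have hq3 : ((ENNReal.ofReal q : ℝ≥0∞) : EReal) = ((q : ℝ) : EReal) := by
    rw [EReal.coe_ennreal_ofReal, max_eq_left hq0]
  rw [← hq3, EReal.coe_ennreal_lt_coe_ennreal_iff] at hq1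
  have h3 := h _ this h2 q hq1
  rw [← ENNReal.exp_log b, EReal.exp_le_exp_iff, EReal.neg_le, hq3] at h3
  exact h3.trans_lt hq2

/-- The probability measure with density proportional to `u`. -/
noncomputable def normalizedMeasure (u : ℝ → ℝ≥0∞) : Measure ℝ :=
  (∫⁻ x, u x)⁻¹ • volume.withDensity u

theorem isProbabilityMeasure_normalizedMeasure {u : ℝ → ℝ≥0∞} (h0 : ∫⁻ x, u x ≠ 0)
    (h1 : ∫⁻ x, u x ≠ ⊤) : IsProbabilityMeasure (normalizedMeasure u) := by
  constructor
  simp only [normalizedMeasure, Measure.smul_apply, smul_eq_mul]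
  rw [withDensity_apply _ MeasurableSet.univ, Measure.restrict_univ,
    ENNReal.inv_mul_cancel h0 h1]

theorem ae_normalizedMeasure {u : ℝ → ℝ≥0∞} (hu : Measurable u) {s : Set ℝ}
    (hs : ∀ x, u x ≠ 0 → x ∈ s) : ∀ᵐ x ∂(normalizedMeasure u), x ∈ s := by
  have h1 : ∀ᵐ x ∂(volume.withDensity u), x ∈ s :=
    (ae_withDensity_iff hu).2 (Eventually.of_forall hs)
  exact Measure.ae_smul_measure h1 _

theorem realEnergy_normalizedMeasure {u : ℝ → ℝ≥0∞} (hu : Measurable u) (h0 : ∫⁻ x, u x ≠ 0)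
    (htop : ∀ x, u x ≠ ⊤) :
    realEnergy (normalizedMeasure u) = densityEnergy u / (∫⁻ x, u x) ^ 2 := by
  have hM : (∫⁻ x, u x)⁻¹ ≠ ⊤ := ENNReal.inv_ne_top.2 h0
  have hk : ∀ y, Measurable fun x => realKernel x y := fun y =>
    measurable_realKernel_comp measurable_id measurable_const
  have h1 : ∀ y, ∫⁻ x, realKernel x y ∂(normalizedMeasure u) =
      (∫⁻ x, u x)⁻¹ * ∫⁻ x, u x * realKernel x y := by
    intro y
    rw [normalizedMeasure, lintegral_smul_measure, lintegral_withDensity_eq_lintegral_mul _ hu (hk y)]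
    rfl
  have h2 : Measurable fun y => ∫⁻ x, u x * realKernel x y :=
    Measurable.lintegral_prod_left ((hu.comp measurable_fst).mul measurable_realKernel)
  unfold realEnergy
  simp_rw [h1]
  rw [lintegral_const_mul' _ _ hM, normalizedMeasure, lintegral_smul_measure,
    lintegral_withDensity_eq_lintegral_mul _ hu h2, smul_eq_mul, ← mul_assoc,
    ENNReal.div_eq_inv_mul, ENNReal.inv_pow, ← sq]
  congr 1
  unfold densityEnergy
  rw [lintegral_lintegral_swap]
  · refine lintegral_congr fun y => ?_
    rw [Pi.mul_apply, ← lintegral_const_mul' _ _ (htop y)]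
    refine lintegral_congr fun x => ?_
    ring
  · exact (measurable_realKernel.mul
      ((hu.comp measurable_fst).mul (hu.comp measurable_snd))).aemeasurable

theorem realEnergy_normalizedMeasure_le {u : ℝ → ℝ≥0∞} (hu : u ∈ stepDensity) {t : ℝ≥0∞}
    (h : densityEnergy u < t * (∫⁻ x, u x) ^ 2) :
    IsProbabilityMeasure (normalizedMeasure u) ∧ realEnergy (normalizedMeasure u) ≤ t := by
  have h0 : ∫⁻ x, u x ≠ 0 := by
    intro h0
    simp [h0] at h
  have h1 := lintegral_ne_top_of_mem_stepDensity hu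
  refine ⟨isProbabilityMeasure_normalizedMeasure h0 h1, ?_⟩
  obtain ⟨B, hB, hB'⟩ := bounded_of_mem_stepDensity hu
  rw [realEnergy_normalizedMeasure (measurable_of_mem_stepDensity hu) h0
    fun x => ne_top_of_le_ne_top hB (hB' x)]
  exact ENNReal.div_le_of_le_mul h.le

/-- The uniform density on `[0, 1)` has finite energy. -/
theorem logCapacity_Icc_pos : 0 < logCapacity (((↑) : ℝ → ℂ) '' Icc (0 : ℝ) 1) := by
  have hu := mul_cellDensity_mem_stepDensity 1 0 0 (s := 0) ⟨le_rfl, one_pos⟩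
  simp only [Nat.cast_one, Nat.cast_zero, zero_add, div_one, one_mul] at hu
  have h1 := lintegral_cellDensity 0 0
  have h2 := densityEnergy_ne_top_of_mem_stepDensity hu
  have h3 : densityEnergy (fun x => cellDensity 0 0 x) <
      (densityEnergy (fun x => cellDensity 0 0 x) + 1) * (∫⁻ x, cellDensity 0 0 x) ^ 2 := by
    rw [h1, one_pow, mul_one]
    exact ENNReal.lt_add_right h2 one_ne_zero
  obtain ⟨hp, he⟩ := realEnergy_normalizedMeasure_le hu h3
  refine lt_of_lt_of_le ?_ (exp_neg_realEnergy_le_logCapacity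
    (normalizedMeasure fun x => cellDensity 0 0 x) isCompact_Icc subset_rfl subset_rfl
    (ae_normalizedMeasure (measurable_of_mem_stepDensity hu) fun x hx =>
      Ico_subset_Icc_self (mem_Ico_of_mem_stepDensity hu hx)))
  rw [EReal.zero_lt_exp_iff, bot_lt_iff_ne_bot, Ne, EReal.neg_eq_bot_iff,
    EReal.coe_ennreal_eq_top_iff]
  exact ne_top_of_le_ne_top (by finiteness) he

/-- Lower semicontinuity of the energy along nested supports. -/
theorem exists_measure_of_antitone (μ : ℕ → Measure ℝ) (hμ : ∀ j, IsProbabilityMeasure (μ j))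
    (K : ℕ → Set ℝ) (hK : ∀ j, IsClosed (K j)) (hKa : Antitone K) (hK1 : K 0 ⊆ Icc 0 1)
    (hμK : ∀ j, ∀ᵐ x ∂(μ j), x ∈ K j) {t : ℝ≥0∞} (ht : ∀ j, realEnergy (μ j) ≤ t) :
    ∃ ν : Measure ℝ, IsProbabilityMeasure ν ∧ (∀ᵐ x ∂ν, x ∈ ⋂ j, K j) ∧ realEnergy ν ≤ t := by
  let m : ℕ → ProbabilityMeasure ℝ := fun j => ⟨μ j, hμ j⟩
  have htight : IsTightMeasureSet {((q : ProbabilityMeasure ℝ) : Measure ℝ) | q ∈ range m} := by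
    rw [isTightMeasureSet_iff_exists_isCompact_measure_compl_le]
    intro ε _
    refine ⟨Icc 0 1, isCompact_Icc, ?_⟩
    rintro _ ⟨_, ⟨j, rfl⟩, rfl⟩
    have h1 : ∀ᵐ x ∂(μ j), x ∈ Icc (0 : ℝ) 1 := by
      filter_upwards [hμK j] with x hx using hK1 (hKa (Nat.zero_le j) hx)
    rw [ae_iff] at h1
    exact (le_of_eq h1).trans zero_le
  have hcomp := isCompact_closure_of_isTightMeasureSet htight
  -- A limit along an ultrafilter finer than `atTop` replaces the extraction of a subsequence.
  obtain ⟨ν, -, hν⟩ := hcomp.ultrafilter_le_nhds ((hyperfilter ℕ).map m)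
    (by
      rw [le_principal_iff]
      exact Filter.mem_map.2 (Filter.univ_mem' fun j => subset_closure (mem_range_self j)))
  have hlim : Tendsto m (hyperfilter ℕ : Filter ℕ) (𝓝 ν) := hν
  refine ⟨ν, inferInstance, ?_, ?_⟩
  · have h1 : ∀ j, ∀ᵐ x ∂(ν : Measure ℝ), x ∈ K j := by
      intro j
      rw [ae_iff]
      -- The complement of `K j` is open and null for all late measures, hence null for the limit.
      have h2 := ProbabilityMeasure.le_liminf_measure_open_of_tendsto hlim (hK j).isOpen_compl
      have h3 : ∀ᶠ i in (hyperfilter ℕ : Filter ℕ), (m i : Measure ℝ) (K j)ᶜ = 0 := by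
        have h4 : ∀ᶠ i in (hyperfilter ℕ : Filter ℕ), j ≤ i :=
          (Nat.hyperfilter_le_atTop) (eventually_ge_atTop j)
        filter_upwards [h4] with i hi
        have h5 : ∀ᵐ x ∂(μ i), x ∈ K j := by
          filter_upwards [hμK i] with x hx using hKa hi hx
        exact ae_iff.1 h5
      rw [liminf_congr h3, liminf_const] at h2
      exact le_antisymm h2 zero_le
    simpa only [mem_iInter] using ae_all_iff.2 h1
  · have hprod : Tendsto (fun j => (m j).prod (m j)) (hyperfilter ℕ : Filter ℕ)
        (𝓝 (ν.prod ν)) :=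
      (ProbabilityMeasure.continuous_prod.tendsto (ν, ν)).comp (hlim.prodMk_nhds hlim)
    rw [realEnergy_eq_lintegral_prod]
    -- The truncated kernels are bounded and continuous, so weak convergence applies to them.
    -- Monotone convergence then recovers the kernel.
    have hsup : ∀ p : ℝ × ℝ, realKernel p.1 p.2 = ⨆ n : ℕ, min (realKernel p.1 p.2) n := by
      intro p
      have h1 := inf_iSup_eq (realKernel p.1 p.2) fun n : ℕ => (n : ℝ≥0∞)
      rw [ENNReal.iSup_natCast, inf_top_eq] at h1
      exact h1
    rw [lintegral_congr hsup]
    rw [lintegral_iSup (fun n => measurable_realKernel.min measurable_const)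
      fun a b hab p => min_le_min le_rfl (by exact_mod_cast hab)]
    refine iSup_le fun n => ?_
    have htop : ∀ p : ℝ × ℝ, min (realKernel p.1 p.2) n ≠ ⊤ := fun p =>
      ne_top_of_le_ne_top (ENNReal.natCast_ne_top n) (min_le_right _ _)
    have hcont : Continuous fun p : ℝ × ℝ => (min (realKernel p.1 p.2) n).toNNReal :=
      ENNReal.continuousOn_toNNReal.comp_continuous (continuous_realKernel.min continuous_const)
        htop
    have hbd : ∀ p : ℝ × ℝ, ((min (realKernel p.1 p.2) n).toNNReal : ℝ) ≤ n := by
      intro p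
      have := ENNReal.toNNReal_mono (ENNReal.natCast_ne_top n) (min_le_right (realKernel p.1 p.2) n)
      rw [ENNReal.toNNReal_natCast] at this
      exact_mod_cast this
    let F : BoundedContinuousFunction (ℝ × ℝ) NNReal :=
      BoundedContinuousFunction.mkOfBound ⟨_, hcont⟩ n fun p q => by
        have h1 := hbd p
        have h2 := hbd q
        rw [NNReal.dist_eq, abs_le]
        constructor <;> simp only [ContinuousMap.coe_mk] <;>
          linarith [NNReal.coe_nonneg (min (realKernel p.1 p.2) n).toNNReal,
            NNReal.coe_nonneg (min (realKernel q.1 q.2) n).toNNReal]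
    have hF : ∀ p, (F p : ℝ≥0∞) = min (realKernel p.1 p.2) n := fun p =>
      ENNReal.coe_toNNReal (htop p)
    have h1 := (ProbabilityMeasure.tendsto_iff_forall_lintegral_tendsto.1 hprod) F
    simp_rw [hF] at h1
    refine le_of_tendsto h1 (Eventually.of_forall fun j => ?_)
    calc ∫⁻ p, min (realKernel p.1 p.2) n ∂((m j).prod (m j) : Measure (ℝ × ℝ))
        ≤ ∫⁻ p, realKernel p.1 p.2 ∂((μ j).prod (μ j)) :=
          lintegral_mono fun p => min_le_left _ _
      _ ≤ t := by
          have := hμ j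
          rw [← realEnergy_eq_lintegral_prod]
          exact ht j

/-! ### Random step densities -/

/-- The sum over `k ∈ s` of `g (c k) / (k + 1)` times the uniform density on the dyadic cell of
generation `m k` that contains `c k`. -/
noncomputable def blockDensity (s : Finset ℕ) (m : ℕ → ℕ) (g : ℝ → ℕ) (c : ℕ → ℝ) (x : ℝ) :
    ℝ≥0∞ :=
  ∑ k ∈ s, (g (c k) : ℝ≥0∞) / (k + 1) * cellDensity (m k) (c k) x

/-- The partial sum of the harmonic series over `s`. -/
noncomputable def harmonicWeight (s : Finset ℕ) : ℝ≥0∞ := ∑ k ∈ s, ((k : ℝ≥0∞) + 1)⁻¹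

theorem harmonicWeight_ne_top (s : Finset ℕ) : harmonicWeight s ≠ ⊤ :=
  ENNReal.sum_ne_top.2 fun k _ => ENNReal.inv_ne_top.2 (by simp)

theorem blockDensity_mem_stepDensity (s : Finset ℕ) (m : ℕ → ℕ) {g : ℝ → ℕ}
    (hg : ∀ x, g x ≠ 0 → x ∈ Ico (0 : ℝ) 1) (c : ℕ → ℝ) : blockDensity s m g c ∈ stepDensity := by
  have h : blockDensity s m g c = ∑ k ∈ s,
      fun x => (g (c k) : ℝ≥0∞) / (k + 1) * cellDensity (m k) (c k) x := by
    ext x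
    simp [blockDensity]
  rw [h]
  refine sum_mem fun k _ => ?_
  by_cases hk : g (c k) = 0
  · simp only [hk, Nat.cast_zero, ENNReal.zero_div, zero_mul]
    exact zero_mem _
  · exact mul_cellDensity_mem_stepDensity _ _ _ (hg _ hk)

theorem lintegral_blockDensity (s : Finset ℕ) (m : ℕ → ℕ) (g : ℝ → ℕ) (c : ℕ → ℝ) :
    ∫⁻ x, blockDensity s m g c x = ∑ k ∈ s, (g (c k) : ℝ≥0∞) / (k + 1) := by
  unfold blockDensity
  rw [lintegral_finsetSum _ fun k _ => (measurable_cellDensity_right _ _).const_mul _]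
  refine Finset.sum_congr rfl fun k _ => ?_
  rw [lintegral_const_mul _ (measurable_cellDensity_right _ _), lintegral_cellDensity, mul_one]

theorem lintegral_blockDensity_le (s : Finset ℕ) (m : ℕ → ℕ) {g : ℝ → ℕ} {G : ℕ}
    (hG : ∀ x, g x ≤ G) (c : ℕ → ℝ) :
    ∫⁻ x, blockDensity s m g c x ≤ G * harmonicWeight s := by
  rw [lintegral_blockDensity, harmonicWeight, Finset.mul_sum]
  refine Finset.sum_le_sum fun k _ => ?_
  rw [div_eq_mul_inv]
  gcongr
  exact hG _

section Random

variable {Ω : Type*} [MeasurableSpace Ω] {P : Measure Ω} {c : ℕ → Ω → ℝ} {π : Measure ℝ}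

theorem measurable_blockDensity_uncurry {s : Finset ℕ} (hc : ∀ k ∈ s, Measurable (c k))
    (m : ℕ → ℕ) {g : ℝ → ℕ} (hg : Measurable g) :
    Measurable fun p : Ω × ℝ => blockDensity s m g (fun k => c k p.1) p.2 := by
  unfold blockDensity
  refine Finset.measurable_fun_sum _ fun k hk => ?_
  refine Measurable.mul ?_ (measurable_cellDensity_comp _ ((hc k hk).comp measurable_fst)
    measurable_snd)
  refine Measurable.div_const ?_ _
  exact (measurable_from_top (f := fun n : ℕ => (n : ℝ≥0∞))).comp
    (hg.comp ((hc k hk).comp measurable_fst))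

theorem lintegral_comp_of_map_eq (hc : ∀ k, Measurable (c k)) (hlaw : ∀ k, P.map (c k) = π)
    {F : ℝ → ℝ≥0∞} (hF : Measurable F) (k : ℕ) : ∫⁻ ω, F (c k ω) ∂P = ∫⁻ x, F x ∂π := by
  rw [← hlaw k, lintegral_map hF (hc k)]

/-- Distinct indices factor by independence. For equal indices, one weight is bounded by `G` and one
cell is renamed as the cell of `x`, which leaves a single average to bound by `H x`. -/
theorem lintegral_mul_cellDensity_le (hc : ∀ k, Measurable (c k)) (hindep : iIndepFun c P)
    (hlaw : ∀ k, P.map (c k) = π) {m : ℕ → ℕ} {g : ℝ → ℕ} (hg : Measurable g) {G : ℕ}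
    (hG : ∀ x, g x ≤ G) {H : ℝ → ℝ≥0∞} {s : Finset ℕ}
    (hH : ∀ k ∈ s, ∀ x, ∫⁻ z, g z * cellDensity (m k) z x ∂π ≤ H x)
    {j k : ℕ} (hj : j ∈ s) (hk : k ∈ s) (x y : ℝ) :
    ∫⁻ ω, (g (c j ω) * cellDensity (m j) (c j ω) x) * (g (c k ω) * cellDensity (m k) (c k ω) y) ∂P
      ≤ H x * H y + if j = k then G * (cellDensity (m k) x y * H x) else 0 := by
  have hgm : Measurable fun z : ℝ => (g z : ℝ≥0∞) :=
    (measurable_from_top (f := fun n : ℕ => (n : ℝ≥0∞))).comp hg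
  have hF : ∀ k x, Measurable fun z : ℝ => (g z : ℝ≥0∞) * cellDensity (m k) z x := fun k x =>
    hgm.mul (measurable_cellDensity_left _ _)
  by_cases hjk : j = k
  · subst hjk
    rw [if_pos rfl]
    refine le_trans ?_ le_add_self
    calc ∫⁻ ω, (g (c j ω) * cellDensity (m j) (c j ω) x) *
          (g (c j ω) * cellDensity (m j) (c j ω) y) ∂P
        ≤ ∫⁻ ω, (G * cellDensity (m j) x y) * (g (c j ω) * cellDensity (m j) (c j ω) x) ∂P := by
          refine lintegral_mono fun ω => ?_
          have h1 : (g (c j ω) : ℝ≥0∞) ≤ G := by exact_mod_cast hG _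
          calc (g (c j ω) * cellDensity (m j) (c j ω) x) * (g (c j ω) * cellDensity (m j) (c j ω) y)
              = g (c j ω) * g (c j ω) *
                (cellDensity (m j) (c j ω) x * cellDensity (m j) (c j ω) y) := by ring
            _ ≤ G * g (c j ω) *
                (cellDensity (m j) (c j ω) x * cellDensity (m j) x y) := by
              rw [cellDensity_mul_cellDensity]
              gcongr
            _ = _ := by ring
      _ = (G * cellDensity (m j) x y) * ∫⁻ z, g z * cellDensity (m j) z x ∂π := by
          rw [lintegral_const_mul' _ _
            (ENNReal.mul_ne_top (ENNReal.natCast_ne_top _) (cellDensity_ne_top _ _ _)),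
            lintegral_comp_of_map_eq hc hlaw (hF j x) j]
      _ ≤ _ := by
          rw [mul_assoc]
          gcongr
          exact hH j hj x
  · rw [if_neg hjk, add_zero]
    have hi : IndepFun (fun ω => (g (c j ω) : ℝ≥0∞) * cellDensity (m j) (c j ω) x)
        (fun ω => (g (c k ω) : ℝ≥0∞) * cellDensity (m k) (c k ω) y) P :=
      (hindep.indepFun hjk).comp (hF j x) (hF k y)
    have h1 := lintegral_mul_eq_lintegral_mul_lintegral_of_indepFun
      ((hF j x).comp (hc j)) ((hF k y).comp (hc k)) hi
    refine (le_of_eq h1).trans ?_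
    refine mul_le_mul' ?_ ?_
    · exact (le_of_eq (lintegral_comp_of_map_eq hc hlaw (hF j x) j)).trans (hH j hj x)
    · exact (le_of_eq (lintegral_comp_of_map_eq hc hlaw (hF k y) k)).trans (hH k hk y)

theorem lintegral_blockDensity_mul_le (hc : ∀ k, Measurable (c k)) (hindep : iIndepFun c P)
    (hlaw : ∀ k, P.map (c k) = π) {m : ℕ → ℕ} {g : ℝ → ℕ} (hg : Measurable g) {G : ℕ}
    (hG : ∀ x, g x ≤ G) {H : ℝ → ℝ≥0∞} {s : Finset ℕ}
    (hH : ∀ k ∈ s, ∀ x, ∫⁻ z, g z * cellDensity (m k) z x ∂π ≤ H x) (x y : ℝ) :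
    ∫⁻ ω, blockDensity s m g (fun k => c k ω) x * blockDensity s m g (fun k => c k ω) y ∂P
      ≤ harmonicWeight s ^ 2 * (H x * H y) +
        ∑ k ∈ s, ((k : ℝ≥0∞) + 1)⁻¹ ^ 2 * (G * (cellDensity (m k) x y * H x)) := by
  have hgm : Measurable fun z : ℝ => (g z : ℝ≥0∞) :=
    (measurable_from_top (f := fun n : ℕ => (n : ℝ≥0∞))).comp hg
  have hF : ∀ k x, Measurable fun ω => (g (c k ω) : ℝ≥0∞) * cellDensity (m k) (c k ω) x :=
    fun k x => (hgm.mul (measurable_cellDensity_left _ _)).comp (hc k)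
  have hF2 : ∀ j k : ℕ, Measurable fun ω => ((j : ℝ≥0∞) + 1)⁻¹ * ((k : ℝ≥0∞) + 1)⁻¹ *
      ((g (c j ω) * cellDensity (m j) (c j ω) x) * (g (c k ω) * cellDensity (m k) (c k ω) y)) :=
    fun j k => ((hF j x).mul (hF k y)).const_mul _
  have h1 : ∀ ω, blockDensity s m g (fun k => c k ω) x * blockDensity s m g (fun k => c k ω) y =
      ∑ j ∈ s, ∑ k ∈ s, ((j : ℝ≥0∞) + 1)⁻¹ * ((k : ℝ≥0∞) + 1)⁻¹ *
        ((g (c j ω) * cellDensity (m j) (c j ω) x) *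
          (g (c k ω) * cellDensity (m k) (c k ω) y)) := by
    intro ω
    unfold blockDensity
    rw [Finset.sum_mul_sum]
    refine Finset.sum_congr rfl fun j _ => Finset.sum_congr rfl fun k _ => ?_
    rw [div_eq_mul_inv, div_eq_mul_inv]
    ring
  simp_rw [h1]
  rw [lintegral_finsetSum _ fun j _ => Finset.measurable_fun_sum _ fun k _ => hF2 j k]
  calc ∑ j ∈ s, ∫⁻ ω, ∑ k ∈ s, ((j : ℝ≥0∞) + 1)⁻¹ * ((k : ℝ≥0∞) + 1)⁻¹ *
        ((g (c j ω) * cellDensity (m j) (c j ω) x) *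
          (g (c k ω) * cellDensity (m k) (c k ω) y)) ∂P
      ≤ ∑ j ∈ s, ∑ k ∈ s, ((j : ℝ≥0∞) + 1)⁻¹ * ((k : ℝ≥0∞) + 1)⁻¹ *
        (H x * H y + if j = k then G * (cellDensity (m k) x y * H x) else 0) := by
        refine Finset.sum_le_sum fun j hj => ?_
        rw [lintegral_finsetSum _ fun k _ => hF2 j k]
        refine Finset.sum_le_sum fun k hk => ?_
        rw [lintegral_const_mul' _ _ (ENNReal.mul_ne_top (ENNReal.inv_ne_top.2 (by simp))
          (ENNReal.inv_ne_top.2 (by simp)))]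
        gcongr
        exact lintegral_mul_cellDensity_le hc hindep hlaw hg hG hH hj hk x y
    _ = _ := by
        simp_rw [mul_add, Finset.sum_add_distrib]
        congr 1
        · rw [harmonicWeight, sq, Finset.sum_mul_sum, Finset.sum_mul]
          refine Finset.sum_congr rfl fun j _ => ?_
          rw [Finset.sum_mul]
        · refine Finset.sum_congr rfl fun j hj => ?_
          simp only [mul_ite, mul_zero, Finset.sum_ite_eq, hj, if_true, sq]

theorem lintegral_densityEnergy [SFinite P] {U : Ω → ℝ → ℝ≥0∞}
    (hU : Measurable fun p : Ω × ℝ => U p.1 p.2) :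
    ∫⁻ ω, densityEnergy (U ω) ∂P = ∫⁻ x, ∫⁻ y, realKernel x y * ∫⁻ ω, U ω x * U ω y ∂P := by
  have hU1 : ∀ x, Measurable fun ω => U ω x := fun x => by
    have h1 : Measurable fun ω : Ω => (ω, x) := by fun_prop
    exact hU.comp h1
  have hk : Measurable fun z : (Ω × ℝ) × ℝ => realKernel z.1.2 z.2 :=
    measurable_realKernel_comp (by fun_prop) measurable_snd
  have ha : Measurable fun z : (Ω × ℝ) × ℝ => U z.1.1 z.1.2 := hU.comp measurable_fst
  have hb' : Measurable fun z : (Ω × ℝ) × ℝ => (z.1.1, z.2) := by fun_prop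
  have hb : Measurable fun z : (Ω × ℝ) × ℝ => U z.1.1 z.2 := hU.comp hb'
  have hU2 : Measurable fun z : (Ω × ℝ) × ℝ => realKernel z.1.2 z.2 * (U z.1.1 z.1.2 * U z.1.1 z.2) :=
    hk.mul (ha.mul hb)
  have hU3 : Measurable fun p : Ω × ℝ => ∫⁻ y, realKernel p.2 y * (U p.1 p.2 * U p.1 y) :=
    Measurable.lintegral_prod_right hU2
  unfold densityEnergy
  rw [lintegral_lintegral_swap hU3.aemeasurable]
  refine lintegral_congr fun x => ?_
  have hU4 : Measurable fun p : Ω × ℝ => realKernel x p.2 * (U p.1 x * U p.1 p.2) :=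
    (measurable_realKernel_comp measurable_const measurable_snd).mul
      (((hU1 x).comp measurable_fst).mul hU)
  rw [lintegral_lintegral_swap hU4.aemeasurable]
  refine lintegral_congr fun y => ?_
  exact lintegral_const_mul _ ((hU1 x).mul (hU1 y))

/-- A diagonal term has weight `(k + 1)⁻¹ ^ 2` against a self-energy of at most `C * (k + 1)`. The
diagonal therefore grows like the first power of the harmonic weight, and the main term like its
square. -/
theorem lintegral_densityEnergy_blockDensity_le [SFinite P] (hc : ∀ k, Measurable (c k))
    (hindep : iIndepFun c P) (hlaw : ∀ k, P.map (c k) = π) {m : ℕ → ℕ} {g : ℝ → ℕ}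
    (hg : Measurable g) {G : ℕ} (hG : ∀ x, g x ≤ G) {H : ℝ → ℝ≥0∞} (hHm : Measurable H)
    (hHtop : ∀ x, H x ≠ ⊤) {s : Finset ℕ}
    (hH : ∀ k ∈ s, ∀ x, ∫⁻ z, g z * cellDensity (m k) z x ∂π ≤ H x) {C : ℝ≥0∞}
    (hC : ∀ k : ℕ, ENNReal.ofReal (m k * Real.log 2) + 2 ≤ C * (k + 1)) :
    ∫⁻ ω, densityEnergy (blockDensity s m g fun k => c k ω) ∂P ≤
      harmonicWeight s ^ 2 * densityEnergy H + harmonicWeight s * (G * C * ∫⁻ x, H x) := by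
  have hU := measurable_blockDensity_uncurry (s := s) (fun k _ => hc k) m hg
  have hdiag : ∀ k : ℕ, Measurable fun p : ℝ × ℝ => realKernel p.1 p.2 *
      (((k : ℝ≥0∞) + 1)⁻¹ ^ 2 * (G * (cellDensity (m k) p.1 p.2 * H p.1))) := fun k =>
    measurable_realKernel.mul ((((measurable_cellDensity (m k)).mul
      (hHm.comp measurable_fst)).const_mul _).const_mul _)
  have hmain : Measurable fun p : ℝ × ℝ => realKernel p.1 p.2 *
      (harmonicWeight s ^ 2 * (H p.1 * H p.2)) :=
    measurable_realKernel.mul (((hHm.comp measurable_fst).mul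
      (hHm.comp measurable_snd)).const_mul _)
  have hWtop := harmonicWeight_ne_top s
  rw [lintegral_densityEnergy hU]
  calc ∫⁻ x, ∫⁻ y, realKernel x y * ∫⁻ ω, blockDensity s m g (fun k => c k ω) x *
        blockDensity s m g (fun k => c k ω) y ∂P
      ≤ ∫⁻ x, ∫⁻ y, (realKernel x y * (harmonicWeight s ^ 2 * (H x * H y)) +
        ∑ k ∈ s, realKernel x y *
          (((k : ℝ≥0∞) + 1)⁻¹ ^ 2 * (G * (cellDensity (m k) x y * H x)))) := by
        refine lintegral_mono fun x => lintegral_mono fun y => ?_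
        rw [← Finset.mul_sum, ← mul_add]
        gcongr
        exact lintegral_blockDensity_mul_le hc hindep hlaw hg hG hH x y
    _ = (∫⁻ x, ∫⁻ y, realKernel x y * (harmonicWeight s ^ 2 * (H x * H y))) +
        ∑ k ∈ s, ∫⁻ x, ∫⁻ y, realKernel x y *
          (((k : ℝ≥0∞) + 1)⁻¹ ^ 2 * (G * (cellDensity (m k) x y * H x))) := by
        rw [← lintegral_finsetSum _ fun k _ => Measurable.lintegral_prod_right (hdiag k),
          ← lintegral_add_left (Measurable.lintegral_prod_right hmain)]
        refine lintegral_congr fun x => ?_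
        have hx : Measurable fun y : ℝ => (x, y) := measurable_const.prodMk measurable_id
        have hmain' := hmain.comp hx
        have hdiag' := fun k => (hdiag k).comp hx
        simp only [Function.comp_def] at hmain' hdiag'
        rw [← lintegral_finsetSum _ fun k _ => hdiag' k, ← lintegral_add_left hmain']
    _ ≤ harmonicWeight s ^ 2 * densityEnergy H +
        ∑ k ∈ s, ((k : ℝ≥0∞) + 1)⁻¹ * (G * C * ∫⁻ x, H x) := by
        gcongr with k hk
        · unfold densityEnergy
          rw [← lintegral_const_mul' _ _ (by finiteness)]
          refine lintegral_mono fun x => ?_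
          rw [← lintegral_const_mul' _ _ (by finiteness)]
          refine lintegral_mono fun y => ?_
          exact le_of_eq (by ring)
        · have hk0 : (k : ℝ≥0∞) + 1 ≠ 0 := by simp
          have hkt : (k : ℝ≥0∞) + 1 ≠ ⊤ := by finiteness
          have hkit : ((k : ℝ≥0∞) + 1)⁻¹ ≠ ⊤ := ENNReal.inv_ne_top.2 hk0
          calc ∫⁻ x, ∫⁻ y, realKernel x y *
                (((k : ℝ≥0∞) + 1)⁻¹ ^ 2 * (G * (cellDensity (m k) x y * H x)))
              = ∫⁻ x, (((k : ℝ≥0∞) + 1)⁻¹ ^ 2 * (G * H x)) *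
                  ∫⁻ y, cellDensity (m k) x y * realKernel x y := by
                refine lintegral_congr fun x => ?_
                rw [← lintegral_const_mul' _ _ (ENNReal.mul_ne_top (by finiteness)
                  (ENNReal.mul_ne_top (ENNReal.natCast_ne_top _) (hHtop x)))]
                refine lintegral_congr fun y => ?_
                ring
            _ ≤ ∫⁻ x, (((k : ℝ≥0∞) + 1)⁻¹ ^ 2 * (G * H x)) * (C * (k + 1)) := by
                refine lintegral_mono fun x => ?_
                gcongr
                exact (lintegral_cellDensity_mul_realKernel_le (m k) x x).trans (hC k)
            _ = ∫⁻ x, (((k : ℝ≥0∞) + 1)⁻¹ * (G * C)) * H x := by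
                refine lintegral_congr fun x => ?_
                calc (((k : ℝ≥0∞) + 1)⁻¹ ^ 2 * (G * H x)) * (C * (k + 1))
                    = ((k : ℝ≥0∞) + 1)⁻¹ * (((k : ℝ≥0∞) + 1)⁻¹ * (k + 1)) * (G * C) * H x := by
                      ring
                  _ = _ := by rw [ENNReal.inv_mul_cancel hk0 hkt, mul_one]
            _ = _ := by rw [lintegral_const_mul _ hHm]; ring
    _ = _ := by rw [harmonicWeight, Finset.sum_mul]

end Random

/-! ### Independent blocks: second moment and Borel–Cantelli -/

/-- The divergent harmonic series is cut, from index `r` on, into consecutive intervals of weight at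
least `W`. -/
theorem exists_disjoint_blocks (W : ℝ≥0∞) (hW0 : W ≠ 0) (hW : W ≠ ⊤) (r : ℕ) :
    ∃ s : ℕ → Finset ℕ, Pairwise (Function.onFun Disjoint s) ∧ (∀ i, W ≤ harmonicWeight (s i)) ∧
      ∀ i, ∀ k ∈ s i, i ≤ k ∧ r ≤ k := by
  have hstep : ∀ N : ℕ, ∃ M, W ≤ harmonicWeight (Finset.Ico N M) := by
    intro N
    obtain ⟨M, hM, hNM⟩ := ((Real.tendsto_sum_range_one_div_nat_succ_atTop.eventually_ge_atTop
      (W.toReal + ∑ i ∈ Finset.range N, 1 / ((i : ℝ) + 1))).and (eventually_ge_atTop N)).exists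
    refine ⟨M, ?_⟩
    have h1 : harmonicWeight (Finset.Ico N M) =
        ENNReal.ofReal (∑ i ∈ Finset.Ico N M, 1 / ((i : ℝ) + 1)) := by
      rw [ENNReal.ofReal_sum_of_nonneg fun i _ => by positivity, harmonicWeight]
      refine Finset.sum_congr rfl fun i _ => ?_
      rw [one_div, ENNReal.ofReal_inv_of_pos (by positivity),
        ENNReal.ofReal_add (by positivity) (by norm_num)]
      simp
    rw [h1, Finset.sum_Ico_eq_sub _ hNM, ENNReal.le_ofReal_iff_toReal_le hW]
    · linarith
    · have := ENNReal.toReal_nonneg (a := W)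
      linarith
  choose f hf using hstep
  let N : ℕ → ℕ := fun i => f^[i] r
  have hNs : ∀ i, N (i + 1) = f (N i) := fun i => Function.iterate_succ_apply' f i r
  have hN : StrictMono N := by
    refine strictMono_nat_of_lt_succ fun i => ?_
    rw [hNs]
    -- An empty block would have weight zero, against `W ≠ 0`.
    by_contra h
    have h1 := hf (N i)
    rw [Finset.Ico_eq_empty_of_le (not_lt.1 h)] at h1
    simp [harmonicWeight] at h1
    exact hW0 h1
  refine ⟨fun i => Finset.Ico (N i) (N (i + 1)), ?_, fun i => ?_, fun i k hk => ?_⟩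
  · have key : ∀ i j, i < j →
        Disjoint (Finset.Ico (N i) (N (i + 1))) (Finset.Ico (N j) (N (j + 1))) := by
      intro i j hij
      rw [Finset.disjoint_left]
      intro k hk hk'
      have := hN.monotone (Nat.succ_le_of_lt hij)
      have h1 := (Finset.mem_Ico.1 hk).2
      have h2 := (Finset.mem_Ico.1 hk').1
      simp only [Nat.succ_eq_add_one] at this
      omega
    intro i j hij
    rcases lt_or_gt_of_ne hij with h | h
    · exact key i j h
    · exact (key j i h).symm
  · show W ≤ harmonicWeight (Finset.Ico (N i) (N (i + 1)))
    rw [hNs]; exact hf _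
  · have h1 := (Finset.mem_Ico.1 hk).1
    have h2 := hN.le_apply (x := i)
    have h3 : r ≤ N i := hN.monotone (Nat.zero_le i)
    omega

section Random

variable {Ω : Type*} [mΩ : MeasurableSpace Ω] {P : Measure Ω} {c : ℕ → Ω → ℝ} {π : Measure ℝ}

theorem measurableSet_blockEvent {s : Finset ℕ} (hc : ∀ k ∈ s, Measurable (c k)) (m : ℕ → ℕ)
    {g : ℝ → ℕ} (hg : Measurable g) (t : ℝ≥0∞) :
    MeasurableSet {ω | densityEnergy (blockDensity s m g fun k => c k ω) <
      t * (∫⁻ x, blockDensity s m g (fun k => c k ω) x) ^ 2} := by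
  have hU := measurable_blockDensity_uncurry hc m hg
  have h1 : Measurable fun ω => ∫⁻ x, blockDensity s m g (fun k => c k ω) x :=
    Measurable.lintegral_prod_right hU
  have hk : Measurable fun z : (Ω × ℝ) × ℝ => realKernel z.1.2 z.2 :=
    measurable_realKernel_comp (by fun_prop) measurable_snd
  have hb' : Measurable fun z : (Ω × ℝ) × ℝ => (z.1.1, z.2) := by fun_prop
  have ha : Measurable fun z : (Ω × ℝ) × ℝ => blockDensity s m g (fun k => c k z.1.1) z.1.2 :=
    hU.comp measurable_fst
  have hb : Measurable fun z : (Ω × ℝ) × ℝ => blockDensity s m g (fun k => c k z.1.1) z.2 :=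
    hU.comp hb'
  have h2 : Measurable fun ω => densityEnergy (blockDensity s m g fun k => c k ω) :=
    Measurable.lintegral_prod_right (Measurable.lintegral_prod_right (hk.mul (ha.mul hb)))
  exact measurableSet_lt h2 ((h1.pow_const 2).const_mul _)

/-- Events that depend on disjoint blocks of an independent family are independent. -/
theorem iIndepSet_of_disjoint_blocks (hc : ∀ k, Measurable (c k)) (hindep : iIndepFun c P)
    {s : ℕ → Finset ℕ} (hs : Pairwise (Function.onFun Disjoint s)) {A : ℕ → Set Ω}
    (hA : ∀ i, MeasurableSet[⨆ k ∈ s i, MeasurableSpace.comap (c k) inferInstance] (A i)) :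
    iIndepSet A P := by
  have := hindep.isProbabilityMeasure
  have hle : ∀ k, MeasurableSpace.comap (c k) inferInstance ≤ mΩ := fun k => (hc k).comap_le
  have hAm : ∀ i, MeasurableSet (A i) := fun i =>
    (iSup₂_le fun k _ => hle k : (⨆ k ∈ s i, MeasurableSpace.comap (c k) inferInstance) ≤ mΩ) _
      (hA i)
  rw [iIndepSet_iff_meas_biInter hAm]
  intro F
  induction F using Finset.induction_on with
  | empty => simp
  | insert a F ha ih =>
    have hd : Disjoint (s a : Set ℕ) (⋃ i ∈ F, (s i : Set ℕ)) := by
      rw [disjoint_iUnion₂_right]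
      intro i hi
      rw [Finset.disjoint_coe]
      exact hs fun h => ha (h ▸ hi)
    have hI := indep_iSup_of_disjoint hle hindep hd
    rw [Indep_iff] at hI
    have hF : MeasurableSet[⨆ k ∈ ⋃ i ∈ F, (s i : Set ℕ),
        MeasurableSpace.comap (c k) inferInstance] (⋂ i ∈ F, A i) := by
      refine MeasurableSet.biInter F.countable_toSet fun i hi => ?_
      refine (iSup₂_le fun k hk => ?_ :
        (⨆ k ∈ s i, MeasurableSpace.comap (c k) inferInstance) ≤ _) _ (hA i)
      exact le_iSup₂_of_le k (mem_biUnion hi hk) le_rfl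
    rw [Finset.set_biInter_insert, Finset.prod_insert ha, ← ih]
    exact hI _ _ (hA a) hF

theorem ennreal_two_mul_le_add_sq (a b : ℝ≥0∞) : 2 * a * b ≤ a ^ 2 + b ^ 2 := by
  induction a with
  | top => simp
  | coe a =>
    induction b with
    | top => simp
    | coe b =>
      have h : 2 * (a : ℝ) * b ≤ (a : ℝ) ^ 2 + b ^ 2 := two_mul_le_add_sq _ _
      exact_mod_cast h

/-- Integrate `2 * b * X ≤ b ^ 2 + X ^ 2` with `b` the mean, and cancel `b ^ 2`. -/
theorem sq_lintegral_le [IsProbabilityMeasure P] {X : Ω → ℝ≥0∞} (hX : Measurable X)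
    (hE : ∫⁻ ω, X ω ∂P ≠ ⊤) : (∫⁻ ω, X ω ∂P) ^ 2 ≤ ∫⁻ ω, X ω ^ 2 ∂P := by
  set b := ∫⁻ ω, X ω ∂P with hb
  have h2 : b ^ 2 + b ^ 2 ≤ b ^ 2 + ∫⁻ ω, X ω ^ 2 ∂P := by
    calc b ^ 2 + b ^ 2 = ∫⁻ ω, 2 * b * X ω ∂P := by
          rw [lintegral_const_mul _ hX, ← hb]; ring
      _ ≤ ∫⁻ ω, (b ^ 2 + X ω ^ 2) ∂P := lintegral_mono fun ω => ennreal_two_mul_le_add_sq _ _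
      _ = _ := by
          rw [lintegral_add_left measurable_const]
          simp
  exact (ENNReal.add_le_add_iff_left (by finiteness)).1 h2

/-- The block event has a probability bounded from below, for blocks of large weight. -/
theorem exists_measure_blockEvent_ge [IsProbabilityMeasure P] (hc : ∀ k, Measurable (c k))
    (hindep : iIndepFun c P) (hlaw : ∀ k, P.map (c k) = π) {m : ℕ → ℕ} {g : ℝ → ℕ}
    (hg : Measurable g) {G : ℕ} (hG : ∀ x, g x ≤ G) {H : ℝ → ℝ≥0∞} (hHs : H ∈ stepDensity)
    {C : ℝ≥0∞} (hCtop : C ≠ ⊤) (hC : ∀ k : ℕ, ENNReal.ofReal (m k * Real.log 2) + 2 ≤ C * (k + 1))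
    {t : ℝ≥0∞} (ht : t ≠ ⊤) (hlt : densityEnergy H < t * (∫⁻ z, g z ∂π) ^ 2) :
    ∃ p : ℝ≥0∞, p ≠ 0 ∧ ∃ W : ℝ≥0∞, W ≠ 0 ∧ W ≠ ⊤ ∧ ∀ s : Finset ℕ,
      (∀ k ∈ s, ∀ x, ∫⁻ z, g z * cellDensity (m k) z x ∂π ≤ H x) → W ≤ harmonicWeight s →
      p ≤ P {ω | densityEnergy (blockDensity s m g fun k => c k ω) <
        t * (∫⁻ x, blockDensity s m g (fun k => c k ω) x) ^ 2} := by
  have hgm : Measurable fun z : ℝ => (g z : ℝ≥0∞) :=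
    (measurable_from_top (f := fun n : ℕ => (n : ℝ≥0∞))).comp hg
  obtain ⟨B, hB, hB'⟩ := bounded_of_mem_stepDensity hHs
  have hHm := measurable_of_mem_stepDensity hHs
  have hHtop : ∀ x, H x ≠ ⊤ := fun x => ne_top_of_le_ne_top hB (hB' x)
  set a := ∫⁻ z, g z ∂π with ha
  obtain ⟨d, hd1, hd2⟩ := exists_between hlt
  have hC1 : G * C * ∫⁻ x, H x ≠ ⊤ := ENNReal.mul_ne_top
    (ENNReal.mul_ne_top (ENNReal.natCast_ne_top _) hCtop) (lintegral_ne_top_of_mem_stepDensity hHs)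
  have hdD : d - densityEnergy H ≠ 0 := (tsub_pos_of_lt hd1).ne'
  -- The gap `d - densityEnergy H` absorbs the diagonal energy once the weight exceeds the quotient
  -- below. The gap `t * a ^ 2 - d` is left for the probability. The last `+ 1` keeps `W` nonzero.
  refine ⟨(t * a ^ 2 - d) / (t * G ^ 2 + 1), ?_,
    G * C * (∫⁻ x, H x) / (d - densityEnergy H) + 1, by simp, ?_, ?_⟩
  · exact ENNReal.div_ne_zero.2 ⟨(tsub_pos_of_lt hd2).ne', by finiteness⟩
  · exact ENNReal.add_ne_top.2 ⟨ENNReal.div_ne_top hC1 hdD, ENNReal.one_ne_top⟩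
  intro s hH hs
  set w := harmonicWeight s with hw
  have hwtop : w ≠ ⊤ := harmonicWeight_ne_top s
  have hw0 : w ≠ 0 := by
    intro h
    rw [h] at hs
    simp at hs
  set A := {ω | densityEnergy (blockDensity s m g fun k => c k ω) <
        t * (∫⁻ x, blockDensity s m g (fun k => c k ω) x) ^ 2} with hA
  have hAm : MeasurableSet A := measurableSet_blockEvent (fun k _ => hc k) m hg t
  set X : Ω → ℝ≥0∞ := fun ω => ∫⁻ x, blockDensity s m g (fun k => c k ω) x with hX
  have hXm : Measurable X :=
    Measurable.lintegral_prod_right (measurable_blockDensity_uncurry (fun k _ => hc k) m hg)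
  have hXle : ∀ ω, X ω ≤ G * w := fun ω => lintegral_blockDensity_le s m hG _
  have hEX : ∫⁻ ω, X ω ∂P = a * w := by
    simp only [hX, lintegral_blockDensity, div_eq_mul_inv]
    have hgc : ∀ k, Measurable fun ω => (g (c k ω) : ℝ≥0∞) := fun k => hgm.comp (hc k)
    rw [lintegral_finsetSum _ fun k _ => (hgc k).mul_const _, hw, harmonicWeight,
      Finset.mul_sum]
    refine Finset.sum_congr rfl fun k _ => ?_
    rw [lintegral_mul_const' _ _ (ENNReal.inv_ne_top.2 (by simp)),
      lintegral_comp_of_map_eq hc hlaw hgm k]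
  have hEXtop : ∫⁻ ω, X ω ∂P ≠ ⊤ := by
    refine ne_top_of_le_ne_top ?_ (lintegral_mono hXle)
    simp only [lintegral_const, measure_univ, mul_one]
    exact ENNReal.mul_ne_top (ENNReal.natCast_ne_top _) hwtop
  have hED := lintegral_densityEnergy_blockDensity_le hc hindep hlaw hg hG hHm hHtop hH hC
  rw [← hw] at hED
  have hED2 : ∫⁻ ω, densityEnergy (blockDensity s m g fun k => c k ω) ∂P ≤ w ^ 2 * d := by
    refine hED.trans ?_
    have h1 : G * C * ∫⁻ x, H x ≤ w * (d - densityEnergy H) := by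
      refine (ENNReal.div_le_iff_le_mul (Or.inl hdD) (Or.inl ?_)).1 (le_self_add.trans hs)
      exact ne_top_of_le_ne_top hd2.ne_top tsub_le_self
    calc w ^ 2 * densityEnergy H + w * (G * C * ∫⁻ x, H x)
        ≤ w ^ 2 * densityEnergy H + w * (w * (d - densityEnergy H)) := by gcongr
      _ = w ^ 2 * (densityEnergy H + (d - densityEnergy H)) := by ring
      _ = w ^ 2 * d := by rw [add_tsub_cancel_of_le hd1.le]
  -- Off the event its defining inequality fails, and on the event the mass is at most `G * w`.
  -- Integrating, with mean mass `a * w`, bounds `P A` from below.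
  have hpt : ∀ ω, t * X ω ^ 2 ≤ densityEnergy (blockDensity s m g fun k => c k ω) +
      A.indicator (fun _ => t * (G * w) ^ 2) ω := by
    intro ω
    by_cases hω : ω ∈ A
    · rw [indicator_of_mem hω]
      refine le_trans ?_ le_add_self
      gcongr
      exact hXle ω
    · rw [indicator_of_notMem hω, add_zero]
      exact not_lt.1 hω
  have hmain : w ^ 2 * (t * a ^ 2) ≤ w ^ 2 * (d + t * G ^ 2 * P A) := by
    calc w ^ 2 * (t * a ^ 2) = t * (∫⁻ ω, X ω ∂P) ^ 2 := by rw [hEX]; ring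
      _ ≤ t * ∫⁻ ω, X ω ^ 2 ∂P := by gcongr; exact sq_lintegral_le hXm hEXtop
      _ = ∫⁻ ω, t * X ω ^ 2 ∂P := by rw [lintegral_const_mul' _ _ ht]
      _ ≤ ∫⁻ ω, (densityEnergy (blockDensity s m g fun k => c k ω) +
            A.indicator (fun _ => t * (G * w) ^ 2) ω) ∂P := lintegral_mono hpt
      _ = ∫⁻ ω, densityEnergy (blockDensity s m g fun k => c k ω) ∂P +
            t * (G * w) ^ 2 * P A := by
          rw [lintegral_add_right _ (measurable_const.indicator hAm),
            lintegral_indicator_const hAm]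
      _ ≤ w ^ 2 * d + t * (G * w) ^ 2 * P A := by gcongr
      _ = _ := by ring
  rw [ENNReal.mul_le_mul_iff_right (by positivity) (by finiteness)] at hmain
  refine ENNReal.div_le_of_le_mul ?_
  rw [tsub_le_iff_left]
  refine hmain.trans (add_le_add le_rfl ?_)
  rw [mul_comm]
  exact mul_le_mul' le_rfl le_self_add

/-- Disjoint heavy blocks give independent events of probability at least `p`, so the second
Borel–Cantelli lemma makes infinitely many occur. -/
theorem ae_exists_block [IsProbabilityMeasure P] (hc : ∀ k, Measurable (c k))
    (hindep : iIndepFun c P) (hlaw : ∀ k, P.map (c k) = π) {m : ℕ → ℕ} {g : ℝ → ℕ}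
    (hg : Measurable g) {G : ℕ} (hG : ∀ x, g x ≤ G) {H : ℝ → ℝ≥0∞} (hHs : H ∈ stepDensity)
    {C : ℝ≥0∞} (hCtop : C ≠ ⊤) (hC : ∀ k : ℕ, ENNReal.ofReal (m k * Real.log 2) + 2 ≤ C * (k + 1))
    {t : ℝ≥0∞} (ht : t ≠ ⊤) (hlt : densityEnergy H < t * (∫⁻ z, g z ∂π) ^ 2) {r : ℕ}
    (hH : ∀ k ≥ r, ∀ x, ∫⁻ z, g z * cellDensity (m k) z x ∂π ≤ H x) :
    ∀ᵐ ω ∂P, ∀ n : ℕ, ∃ s : Finset ℕ, (∀ k ∈ s, n ≤ k) ∧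
      densityEnergy (blockDensity s m g fun k => c k ω) <
        t * (∫⁻ x, blockDensity s m g (fun k => c k ω) x) ^ 2 := by
  obtain ⟨p, hp, W, hW0, hW, hPA⟩ :=
    exists_measure_blockEvent_ge hc hindep hlaw hg hG hHs hCtop hC ht hlt
  obtain ⟨s, hdisj, hsW, hsk⟩ := exists_disjoint_blocks W hW0 hW r
  set A : ℕ → Set Ω := fun i => {ω | densityEnergy (blockDensity (s i) m g fun k => c k ω) <
        t * (∫⁻ x, blockDensity (s i) m g (fun k => c k ω) x) ^ 2} with hA
  have hAm : ∀ i, MeasurableSet (A i) := fun i =>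
    measurableSet_blockEvent (fun k _ => hc k) m hg t
  have hAi : iIndepSet A P := by
    refine iIndepSet_of_disjoint_blocks hc hindep hdisj fun i => ?_
    -- The measurability lemma is applied with the σ-algebra generated by the centers of the block
    -- alone.
    refine @measurableSet_blockEvent Ω (⨆ k ∈ s i, MeasurableSpace.comap (c k) inferInstance)
      c (s i) (fun k hk => ?_) m g hg t
    rw [measurable_iff_comap_le]
    exact le_iSup₂_of_le k hk le_rfl
  have hsum : ∑' i, P (A i) = ⊤ := by
    rw [eq_top_iff, ← ENNReal.tsum_const_eq_top_of_ne_zero (α := ℕ) hp]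
    exact ENNReal.tsum_le_tsum fun i => hPA (s i) (fun k hk => hH k (hsk i k hk).2) (hsW i)
  have hlim := measure_limsup_eq_one hAm hAi hsum
  have hae : ∀ᵐ ω ∂P, ω ∈ limsup A atTop := by
    rw [← prob_compl_eq_zero_iff] at hlim
    · exact hlim
    · exact MeasurableSet.measurableSet_limsup hAm
  filter_upwards [hae] with ω hω n
  rw [mem_limsup_iff_frequently_mem, frequently_atTop] at hω
  obtain ⟨i, hi, hiA⟩ := hω n
  exact ⟨s i, fun k hk => hi.trans (hsk i k hk).1, hiA⟩

end Random

/-! ### Integer weights that compensate the density of the centers -/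

/-- An integer-valued truncation of `M * h / F`. -/
noncomputable def weight (h F : ℝ → ℝ≥0∞) (M : ℕ) (x : ℝ) : ℕ :=
  ⌊(min (M * (h x / F x)) ((M ^ 2 : ℕ) : ℝ≥0∞)).toReal⌋₊

theorem weight_le (h F : ℝ → ℝ≥0∞) (M : ℕ) (x : ℝ) : weight h F M x ≤ M ^ 2 := by
  refine Nat.floor_le_of_le ?_
  have := ENNReal.toReal_mono (ENNReal.natCast_ne_top (M ^ 2))
    (min_le_right (M * (h x / F x)) ((M ^ 2 : ℕ) : ℝ≥0∞))
  rwa [ENNReal.toReal_natCast] at this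

theorem measurable_weight {h F : ℝ → ℝ≥0∞} (hh : Measurable h) (hF : Measurable F) (M : ℕ) :
    Measurable (weight h F M) :=
  Nat.measurable_floor.comp
    ((((hh.div hF).const_mul _).min measurable_const).ennreal_toReal)

/-- Rounding down makes this hold everywhere, even where `F` vanishes. It keeps the mean of the
random density below `M * h`. -/
theorem weight_mul_le (h F : ℝ → ℝ≥0∞) (M : ℕ) (x : ℝ) : weight h F M x * F x ≤ M * h x := by
  have h1 : (weight h F M x : ℝ≥0∞) ≤ M * (h x / F x) := by
    rw [← ENNReal.ofReal_natCast]
    refine (ENNReal.ofReal_le_ofReal (Nat.floor_le ENNReal.toReal_nonneg)).trans ?_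
    exact ENNReal.ofReal_toReal_le.trans (min_le_left _ _)
  calc weight h F M x * F x ≤ M * (h x / F x) * F x := by gcongr
    _ = M * (h x / F x * F x) := mul_assoc _ _ _
    _ ≤ M * h x := by gcongr; rw [mul_comm]; exact ENNReal.mul_div_le

theorem weight_ne_zero {h F : ℝ → ℝ≥0∞} {M : ℕ} {x : ℝ} (hw : weight h F M x ≠ 0) : h x ≠ 0 := by
  intro h0
  apply hw
  simp [weight, h0]

/-- Once `M` exceeds `h x / F x` the cap `M ^ 2` is inactive, and only the rounding remains. -/
theorem tendsto_weight_mul {h F : ℝ → ℝ≥0∞} {x : ℝ} (hh : h x ≠ ⊤) (hF0 : F x ≠ 0)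
    (hFt : F x ≠ ⊤) :
    Tendsto (fun M : ℕ => (weight h F M x : ℝ≥0∞) / M * F x) atTop (𝓝 (h x)) := by
  have hq : h x / F x ≠ ⊤ := ENNReal.div_ne_top hh hF0
  set a : ℝ := (h x / F x).toReal with ha
  have h1 : Tendsto (fun M : ℕ => ENNReal.ofReal ((⌊a * (M : ℝ)⌋₊ : ℝ) / M)) atTop
      (𝓝 (ENNReal.ofReal a)) :=
    ENNReal.tendsto_ofReal ((tendsto_nat_floor_mul_div_atTop
      (R := ℝ) ENNReal.toReal_nonneg).comp tendsto_natCast_atTop_atTop)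
  rw [ENNReal.ofReal_toReal hq] at h1
  have h2 := ENNReal.Tendsto.mul_const h1 (Or.inr hFt : h x / F x ≠ 0 ∨ F x ≠ ⊤)
  rw [ENNReal.div_mul_cancel hF0 hFt] at h2
  refine h2.congr' ?_
  obtain ⟨N, hN⟩ := exists_nat_ge a
  filter_upwards [eventually_ge_atTop N, eventually_gt_atTop 0] with M hM hM0
  have hM0' : (0 : ℝ) < M := by exact_mod_cast hM0
  have hMN : (N : ℝ) ≤ M := by exact_mod_cast hM
  have h3 : weight h F M x = ⌊a * (M : ℝ)⌋₊ := by
    unfold weight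
    rw [min_eq_left, ENNReal.toReal_mul, ENNReal.toReal_natCast, mul_comm]
    rw [← ENNReal.ofReal_toReal hq, ← ENNReal.ofReal_natCast M, ← ENNReal.ofReal_natCast,
      ← ENNReal.ofReal_mul hM0'.le]
    refine ENNReal.ofReal_le_ofReal ?_
    push_cast
    nlinarith
  rw [h3, ENNReal.ofReal_div_of_pos hM0', ENNReal.ofReal_natCast, ENNReal.ofReal_natCast]

section Random

variable {Ω : Type*} [MeasurableSpace Ω] {P : Measure Ω} {c : ℕ → Ω → ℝ}

/-- Dominated convergence with bound `h`. Positivity of `f` almost everywhere ensures that none of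
the mass of `h` is lost in the limit. -/
theorem tendsto_lintegral_weight {f : ℝ → ℝ} (hf : Measurable f)
    (hf_pos : ∀ᵐ x ∂(volume.restrict (Icc (0 : ℝ) 1)), 0 < f x) {h : ℝ → ℝ≥0∞}
    (hh : h ∈ stepDensity) :
    Tendsto (fun M : ℕ => (∫⁻ z, weight h (fun x => ENNReal.ofReal (f x)) M z
      ∂((volume.restrict (Icc (0 : ℝ) 1)).withDensity fun x => ENNReal.ofReal (f x))) / M)
      atTop (𝓝 (∫⁻ x, h x)) := by
  set F : ℝ → ℝ≥0∞ := fun x => ENNReal.ofReal (f x) with hF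
  have hFm : Measurable F := hf.ennreal_ofReal
  have hhm := measurable_of_mem_stepDensity hh
  obtain ⟨B, hB, hB'⟩ := bounded_of_mem_stepDensity hh
  have hgm : ∀ M, Measurable fun z : ℝ => (weight h F M z : ℝ≥0∞) := fun M =>
    (measurable_from_top (f := fun n : ℕ => (n : ℝ≥0∞))).comp (measurable_weight hhm hFm M)
  have hIcc : ∫⁻ x, h x = ∫⁻ x in Icc (0 : ℝ) 1, h x := by
    rw [← lintegral_indicator measurableSet_Icc]
    refine lintegral_congr fun x => ?_
    by_cases hx : h x = 0
    · simp [indicator, hx]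
    · rw [indicator_of_mem (Ico_subset_Icc_self (mem_Ico_of_mem_stepDensity hh hx))]
  have h1 : Tendsto (fun M : ℕ => ∫⁻ x in Icc (0 : ℝ) 1, (weight h F M x : ℝ≥0∞) / M * F x) atTop
      (𝓝 (∫⁻ x in Icc (0 : ℝ) 1, h x)) := by
    refine tendsto_lintegral_of_dominated_convergence h
      (fun M => ((hgm M).div_const _).mul hFm) (fun M => Eventually.of_forall fun x => ?_) ?_ ?_
    · show (weight h F M x : ℝ≥0∞) / M * F x ≤ h x
      rcases Nat.eq_zero_or_pos M with rfl | hM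
      · simp [weight]
      · rw [← ENNReal.mul_div_right_comm]
        refine ENNReal.div_le_of_le_mul ?_
        rw [mul_comm (h x)]
        exact weight_mul_le h F M x
    · rw [← hIcc]; exact lintegral_ne_top_of_mem_stepDensity hh
    · filter_upwards [hf_pos] with x hx
      exact tendsto_weight_mul (ne_top_of_le_ne_top hB (hB' x))
        (ENNReal.ofReal_pos.2 hx).ne' ENNReal.ofReal_ne_top
  rw [hIcc]
  refine h1.congr' ?_
  filter_upwards [eventually_gt_atTop 0] with M hM
  have hM' : (M : ℝ≥0∞)⁻¹ ≠ ⊤ := ENNReal.inv_ne_top.2 (by exact_mod_cast hM.ne')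
  rw [lintegral_withDensity_eq_lintegral_mul _ hFm (hgm M), div_eq_mul_inv,
    ← lintegral_mul_const' _ _ hM']
  refine lintegral_congr fun x => ?_
  rw [Pi.mul_apply, div_eq_mul_inv]
  ring

/-- Almost surely, any step density `h` can be replaced by a step density carried by the union of
finitely many of the intervals of large index, without the support getting larger and without
losing the energy bound. -/
theorem ae_exists_stepDensity [IsProbabilityMeasure P] (hc : ∀ k, Measurable (c k))
    (hindep : iIndepFun c P) {f : ℝ → ℝ} (hf : Measurable f)
    (hf_pos : ∀ᵐ x ∂(volume.restrict (Icc (0 : ℝ) 1)), 0 < f x)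
    (hlaw : ∀ k, P.map (c k) =
      (volume.restrict (Icc (0 : ℝ) 1)).withDensity fun x => ENNReal.ofReal (f x))
    {A : ℕ} (hA : 0 < A) {l : ℕ → ℝ} (hl : ∀ k, (1 / 2 : ℝ) ^ (A * (k + 1)) < l k / 2)
    {h : ℝ → ℝ≥0∞} (hh : h ∈ stepDensity) {t : ℝ≥0∞} (ht : t ≠ ⊤)
    (hlt : densityEnergy h < t * (∫⁻ x, h x) ^ 2) :
    ∀ᵐ ω ∂P, ∀ n : ℕ, ∃ u ∈ stepDensity, densityEnergy u < t * (∫⁻ x, u x) ^ 2 ∧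
      (∀ x, u x ≠ 0 → h x ≠ 0) ∧
      closure {x | u x ≠ 0} ⊆ ⋃ k ≥ n, Ioo (c k ω - l k / 2) (c k ω + l k / 2) := by
  set F : ℝ → ℝ≥0∞ := fun x => ENNReal.ofReal (f x) with hF
  have hFm : Measurable F := hf.ennreal_ofReal
  have hhm := measurable_of_mem_stepDensity hh
  set π := (volume.restrict (Icc (0 : ℝ) 1)).withDensity F with hπ
  have hlim : Tendsto (fun M : ℕ => t * ((∫⁻ z, weight h F M z ∂π) / M) ^ 2) atTop
      (𝓝 (t * (∫⁻ x, h x) ^ 2)) :=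
    ENNReal.Tendsto.const_mul (ENNReal.Tendsto.pow (tendsto_lintegral_weight hf hf_pos hh))
      (Or.inr ht)
  obtain ⟨M, hM, hM0⟩ := ((hlim.eventually_const_lt hlt).and (eventually_gt_atTop 0)).exists
  have hM0' : (M : ℝ≥0∞) ≠ 0 := by exact_mod_cast hM0.ne'
  have hMt : (M : ℝ≥0∞) ≠ ⊤ := ENNReal.natCast_ne_top M
  set H : ℝ → ℝ≥0∞ := fun x => M * h x with hH
  have hHs : H ∈ stepDensity := by
    have : H = M • h := by
      ext x
      simp [hH]
    rw [this]
    exact nsmul_mem hh M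
  set g : ℝ → ℕ := weight h F M with hg
  have hgm : Measurable g := measurable_weight hhm hFm M
  have hgm' : Measurable fun z : ℝ => (g z : ℝ≥0∞) :=
    (measurable_from_top (f := fun n : ℕ => (n : ℝ≥0∞))).comp hgm
  have hHlt : densityEnergy H < t * (∫⁻ z, g z ∂π) ^ 2 := by
    rw [hH, densityEnergy_const_mul _ hMt]
    calc (M : ℝ≥0∞) ^ 2 * densityEnergy h
        < (M : ℝ≥0∞) ^ 2 * (t * ((∫⁻ z, g z ∂π) / M) ^ 2) :=
          ENNReal.mul_lt_mul_right (by positivity) (by finiteness) hM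
      _ = t * ((∫⁻ z, g z ∂π) / M * M) ^ 2 := by ring
      _ = _ := by rw [ENNReal.div_mul_cancel hM0' hMt]
  obtain ⟨r, hr⟩ := exists_const_of_mem_stepDensity hh
  have hmr : ∀ k ≥ r, r ≤ A * (k + 1) := fun k hk => by nlinarith
  -- For `k ≥ r` the cells are fine enough that `H` is constant on each, so averaging `g * F ≤ H`
  -- over the cell of `x` gives at most `H x`.
  have hHg : ∀ k ≥ r, ∀ x, ∫⁻ z, g z * cellDensity (A * (k + 1)) z x ∂π ≤ H x := by
    intro k hk x
    have h1 : ∀ x y : ℝ, ⌊(2 : ℝ) ^ (A * (k + 1)) * x⌋ = ⌊(2 : ℝ) ^ (A * (k + 1)) * y⌋ →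
        H x = H y := fun x y hxy => by
      simp only [hH]
      rw [hr _ (hmr k hk) x y hxy]
    have h2 : Measurable fun z => (g z : ℝ≥0∞) * cellDensity (A * (k + 1)) z x :=
      hgm'.mul (measurable_cellDensity_left _ _)
    rw [hπ, lintegral_withDensity_eq_lintegral_mul _ hFm h2, ← lintegral_cellDensity_mul_of_const h1 x]
    refine (setLIntegral_le_lintegral _ _).trans (lintegral_mono fun z => ?_)
    simp only [Pi.mul_apply]
    calc F z * (g z * cellDensity (A * (k + 1)) z x)
        = cellDensity (A * (k + 1)) x z * (g z * F z) := by
          rw [cellDensity_comm _ z x]; ring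
      _ ≤ _ := by gcongr; exact weight_mul_le h F M z
  have hC : ∀ k : ℕ, ENNReal.ofReal ((A * (k + 1) : ℕ) * Real.log 2) + 2 ≤
      (ENNReal.ofReal (A * Real.log 2) + 2) * (k + 1) := by
    intro k
    have hlog : 0 ≤ Real.log 2 := Real.log_nonneg (by norm_num)
    have h1 : ((A * (k + 1) : ℕ) : ℝ) * Real.log 2 = A * Real.log 2 * (k + 1) := by
      push_cast; ring
    rw [h1, ENNReal.ofReal_mul (by positivity), add_mul, ENNReal.ofReal_add (by positivity)
      (by norm_num), ENNReal.ofReal_natCast, ENNReal.ofReal_one]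
    gcongr
    exact le_mul_of_one_le_right zero_le le_add_self
  have hae := ae_exists_block (m := fun k => A * (k + 1)) hc hindep hlaw hgm
    (weight_le h F M) hHs (by finiteness) hC ht hHlt hHg
  filter_upwards [hae] with ω hω n
  -- The bound `n` is the required index; the bound `r` makes `h` constant on every cell used, so
  -- the support does not grow.
  obtain ⟨s, hs, hslt⟩ := hω (max n r)
  have hnz : ∀ x, blockDensity s (fun k => A * (k + 1)) g (fun k => c k ω) x ≠ 0 →
      ∃ k ∈ s, g (c k ω) ≠ 0 ∧
        ⌊(2 : ℝ) ^ (A * (k + 1)) * c k ω⌋ = ⌊(2 : ℝ) ^ (A * (k + 1)) * x⌋ := by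
    intro x hx
    obtain ⟨k, hk, hk'⟩ := Finset.exists_ne_zero_of_sum_ne_zero hx
    refine ⟨k, hk, fun h0 => hk' (by simp [h0]), cellDensity_ne_zero fun h0 => hk' ?_⟩
    rw [h0, mul_zero]
  refine ⟨blockDensity s (fun k => A * (k + 1)) g fun k => c k ω, ?_, hslt, ?_, ?_⟩
  · exact blockDensity_mem_stepDensity _ _
      (fun x hx => mem_Ico_of_mem_stepDensity hh (weight_ne_zero hx)) _
  · intro x hx
    obtain ⟨k, hk, hk1, hk2⟩ := hnz x hx
    rw [← hr _ (hmr k ((le_max_right _ _).trans (hs k hk))) _ _ hk2]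
    exact weight_ne_zero hk1
  · have hcl : IsClosed (⋃ k ∈ s, Metric.closedBall (c k ω) ((1 / 2) ^ (A * (k + 1)))) :=
      s.finite_toSet.isClosed_biUnion fun k _ => Metric.isClosed_closedBall
    refine (closure_minimal ?_ hcl).trans ?_
    · intro x hx
      obtain ⟨k, hk, -, hk2⟩ := hnz x hx
      refine mem_biUnion hk ?_
      rw [Metric.mem_closedBall, dist_comm, Real.dist_eq]
      exact (abs_sub_lt_of_floor_eq hk2).le
    · refine iUnion₂_subset fun k hk x hx => ?_
      refine mem_biUnion (show k ≥ n from (le_max_left _ _).trans (hs k hk)) ?_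
      rw [Metric.mem_closedBall, Real.dist_eq, abs_le] at hx
      have := hl k
      constructor <;> linarith [hx.1, hx.2]

end Random

/-! ### The nested construction -/

/-- If every step density can be moved into the intervals of large index, the limsup set has at
least the capacity of `[0, 1]`. -/
theorem logCapacity_Icc_le_limsupIntervals {c l : ℕ → ℝ}
    (hstep : ∀ q : ℚ, ∀ h ∈ stepDensity,
      densityEnergy h < ENNReal.ofReal q * (∫⁻ x, h x) ^ 2 →
      ∀ n : ℕ, ∃ u ∈ stepDensity, densityEnergy u < ENNReal.ofReal q * (∫⁻ x, u x) ^ 2 ∧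
      (∀ x, u x ≠ 0 → h x ≠ 0) ∧
      closure {x | u x ≠ 0} ⊆ ⋃ k ≥ n, Ioo (c k - l k / 2) (c k + l k / 2)) :
    logCapacity (((↑) : ℝ → ℂ) '' Icc (0 : ℝ) 1) ≤
      logCapacity (((↑) : ℝ → ℂ) '' limsupIntervals c l) := by
  refine logCapacity_Icc_le fun μ hμ hμI q hq => ?_
  obtain ⟨u₀, hu₀, hu₀lt⟩ := exists_stepDensity_of_realEnergy_lt μ hμI hq
  let T := {u : ℝ → ℝ≥0∞ // u ∈ stepDensity ∧
    densityEnergy u < ENNReal.ofReal q * (∫⁻ x, u x) ^ 2}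
  have hnext : ∀ (n : ℕ) (h : T), ∃ u : T, (∀ x, u.1 x ≠ 0 → h.1 x ≠ 0) ∧
      closure {x | u.1 x ≠ 0} ⊆ ⋃ k ≥ n, Ioo (c k - l k / 2) (c k + l k / 2) := by
    intro n h
    obtain ⟨u, hu1, hu2, hu3, hu4⟩ := hstep q h.1 h.2.1 h.2.2 n
    exact ⟨⟨u, hu1, hu2⟩, hu3, hu4⟩
  choose next hnext1 hnext2 using hnext
  let u : ℕ → T := fun j => Nat.rec ⟨u₀, hu₀, hu₀lt⟩ (fun n h => next n h) j
  have hu : ∀ j, u (j + 1) = next j (u j) := fun j => rfl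
  let K : ℕ → Set ℝ := fun j => closure {x | (u j).1 x ≠ 0}
  have hK1 : ∀ j, K j ⊆ Icc 0 1 := fun j => closure_minimal
    (fun x hx => Ico_subset_Icc_self (mem_Ico_of_mem_stepDensity (u j).2.1 hx)) isClosed_Icc
  have hKa : Antitone K := by
    refine antitone_nat_of_succ_le fun j => closure_mono fun x hx => ?_
    have hx' : (u (j + 1)).1 x ≠ 0 := hx
    rw [hu] at hx'
    exact hnext1 j (u j) x hx'
  have hprob : ∀ j, IsProbabilityMeasure (normalizedMeasure (u j).1) ∧
      realEnergy (normalizedMeasure (u j).1) ≤ ENNReal.ofReal q := fun j =>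
    realEnergy_normalizedMeasure_le (u j).2.1 (u j).2.2
  obtain ⟨ν, hν, hνK, hνE⟩ := exists_measure_of_antitone (fun j => normalizedMeasure (u j).1)
    (fun j => (hprob j).1) K (fun j => isClosed_closure) hKa (hK1 0)
    (fun j => ae_normalizedMeasure (measurable_of_mem_stepDensity (u j).2.1)
      fun x hx => subset_closure hx) fun j => (hprob j).2
  have hsub : ⋂ j, K j ⊆ Icc 0 1 := (iInter_subset _ 0).trans (hK1 0)
  refine le_trans ?_ (exp_neg_realEnergy_le_logCapacity ν (K := ⋂ j, K j)
    (isCompact_Icc.of_isClosed_subset (isClosed_iInter fun j => isClosed_closure) hsub) hsub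
    ?_ hνK)
  · rw [EReal.exp_le_exp_iff, EReal.neg_le_neg_iff]
    exact_mod_cast hνE
  -- Stage `n + 1` is the one whose closed support lies in the intervals of index at least `n`.
  · refine subset_iInter fun n x hx => ?_
    have h1 : x ∈ closure {x | (u (n + 1)).1 x ≠ 0} := mem_iInter.1 hx (n + 1)
    rw [hu] at h1
    exact hnext2 n (u n) h1

/-! ### Intervals of length `exp (-Λ k ^ α)` -/

theorem tendsto_expLength {Λ α : ℝ} (hΛ : 0 < Λ) (hα : 0 < α) :
    Tendsto (expLength Λ α) atTop (𝓝 0) := by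
  unfold expLength
  refine Real.tendsto_exp_atBot.comp ?_
  exact ((tendsto_rpow_atTop hα).comp tendsto_natCast_atTop_atTop).const_mul_atTop_of_neg
    (by linarith)

/-- Since the lengths tend to zero, every point of the limsup set is a limit of centers. -/
theorem limsupIntervals_subset_Icc {c l : ℕ → ℝ} (hc : ∀ k, c k ∈ Icc (0 : ℝ) 1)
    (hl : Tendsto l atTop (𝓝 0)) : limsupIntervals c l ⊆ Icc 0 1 := by
  intro x hx
  rw [← isClosed_Icc.closure_eq, Metric.mem_closure_iff]
  intro ε hε
  obtain ⟨m, hm⟩ := eventually_atTop.1 (hl.eventually_lt_const hε)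
  have h1 := mem_iInter.1 hx m
  simp only [mem_iUnion] at h1
  obtain ⟨k, hk, hxk⟩ := h1
  refine ⟨c k, hc k, ?_⟩
  have := hm k hk
  rw [Real.dist_eq, abs_lt]
  constructor <;> linarith [hxk.1, hxk.2]

/-- This is where `α ≤ 1` enters: `k ^ α ≤ k`, so cells of generation linear in `k` fit in the
intervals. The `+ 2` in the witness covers the factor `1 / 2` and strictness. -/
theorem exists_half_pow_lt_expLength {Λ α : ℝ} (hΛ : 0 < Λ) (hα1 : α ≤ 1) (hα : 0 < α) :
    ∃ A : ℕ, 0 < A ∧ ∀ k, (1 / 2 : ℝ) ^ (A * (k + 1)) < expLength Λ α k / 2 := by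
  have hlog : 0 < Real.log 2 := Real.log_pos (by norm_num)
  refine ⟨⌈Λ / Real.log 2⌉₊ + 2, by omega, fun k => ?_⟩
  set A := ⌈Λ / Real.log 2⌉₊ + 2 with hA
  have h1 : Λ + 2 * Real.log 2 ≤ A * Real.log 2 := by
    have := Nat.le_ceil (Λ / Real.log 2)
    rw [div_le_iff₀ hlog] at this
    rw [hA]
    push_cast
    linarith
  have hk0 : (0 : ℝ) ≤ k := Nat.cast_nonneg k
  have h2 : (k : ℝ) ^ α ≤ k := by
    rcases Nat.eq_zero_or_pos k with rfl | hk
    · simp [Real.zero_rpow hα.ne']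
    · have hk1 : (1 : ℝ) ≤ k := by exact_mod_cast hk
      simpa using Real.rpow_le_rpow_of_exponent_le hk1 hα1
  have h3 : (1 / 2 : ℝ) ^ (A * (k + 1)) = Real.exp (-(A * (k + 1) * Real.log 2)) := by
    rw [← Real.exp_log (show (0 : ℝ) < (1 / 2) ^ (A * (k + 1)) by positivity), Real.log_pow,
      one_div, Real.log_inv]
    push_cast
    ring_nf
  have h4 : expLength Λ α k / 2 = Real.exp (-Λ * (k : ℝ) ^ α - Real.log 2) := by
    rw [Real.exp_sub, Real.exp_log (by norm_num), expLength]
  rw [h3, h4, Real.exp_lt_exp]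
  nlinarith [mul_le_mul_of_nonneg_right h1 (by linarith : (0 : ℝ) ≤ k + 1),
    mul_le_mul_of_nonneg_left h2 hΛ.le, mul_nonneg hk0 hlog.le]

/-- Inside interval `k` the kernel is at least `Λ * k ^ α`, with summable reciprocals since `1 < α`.
Indices are shifted by one because this bound is zero at `k = 0`, where its inverse would be
infinite. -/
theorem logCapacity_limsupIntervals_eq_zero {Λ α : ℝ} (hΛ : 0 < Λ) (hα : 1 < α) (c : ℕ → ℝ) :
    logCapacity (((↑) : ℝ → ℂ) '' limsupIntervals c (expLength Λ α)) = 0 := by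
  have hemb : MeasurableEmbedding ((↑) : ℝ → ℂ) :=
    Complex.ofRealLI.isometry.isClosedEmbedding.measurableEmbedding
  refine logCapacity_limsup_eq_zero
    (fun k => ((↑) : ℝ → ℂ) '' Ioo (c (k + 1) - expLength Λ α (k + 1) / 2)
      (c (k + 1) + expLength Λ α (k + 1) / 2))
    (fun k => ENNReal.ofReal (Λ * ((k + 1 : ℕ) : ℝ) ^ α)) ?_
    (fun k => hemb.measurableSet_image.2 measurableSet_Ioo) ?_ _ ?_
  · rintro k _ ⟨x, hx, rfl⟩ _ ⟨y, hy, rfl⟩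
    show _ ≤ realKernel x y
    rcases eq_or_ne x y with rfl | hxy
    · simp [realKernel_self]
    rw [realKernel_of_ne hxy]
    refine ENNReal.ofReal_le_ofReal ?_
    have h1 : |x - y| ≤ expLength Λ α (k + 1) := by
      rw [abs_le]
      constructor <;> linarith [hx.1, hx.2, hy.1, hy.2]
    have h2 := Real.log_le_log (abs_pos.2 (sub_ne_zero.2 hxy)) h1
    rw [expLength, Real.log_exp] at h2
    linarith
  · have h1 : ∀ k : ℕ, (ENNReal.ofReal (Λ * ((k + 1 : ℕ) : ℝ) ^ α))⁻¹ =
        ENNReal.ofReal (Λ⁻¹ * (1 / ((k + 1 : ℕ) : ℝ) ^ α)) := by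
      intro k
      rw [← ENNReal.ofReal_inv_of_pos (by positivity), mul_inv, one_div]
    simp_rw [h1]
    have h2 : Summable fun k : ℕ => Λ⁻¹ * (1 / ((k + 1 : ℕ) : ℝ) ^ α) :=
      ((summable_nat_add_iff 1).2 (Real.summable_one_div_nat_rpow.2 hα)).mul_left _
    exact h2.tsum_ofReal_ne_top
  · rintro _ ⟨x, hx, rfl⟩
    refine mem_iInter.2 fun m => ?_
    have h1 := mem_iInter.1 hx (m + 1)
    simp only [mem_iUnion] at h1
    obtain ⟨k, hk, hxk⟩ := h1
    obtain ⟨j, rfl⟩ : ∃ j, k = j + 1 := ⟨k - 1, by omega⟩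
    exact mem_biUnion (show j ≥ m by omega) ⟨x, hxk, rfl⟩

end

/-! ### The phase transition -/

theorem mainTheorem2 {Ω : Type*} [MeasurableSpace Ω] (P : Measure Ω) [IsProbabilityMeasure P]
    (c : ℕ → Ω → ℝ) (hc_meas : ∀ k, Measurable (c k)) (hc_indep : iIndepFun c P)
    (f : ℝ → ℝ) (hf_meas : Measurable f)
    (hf_pos : ∀ᵐ x ∂(volume.restrict (Icc (0 : ℝ) 1)), 0 < f x)
    (hf_bdd : ∃ K : ℝ, ∀ᵐ x ∂(volume.restrict (Icc (0 : ℝ) 1)), f x ≤ K)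
    (hc_law : ∀ k, P.map (c k) =
      (volume.restrict (Icc (0 : ℝ) 1)).withDensity (fun x => ENNReal.ofReal (f x)))
    (Λ α : ℝ) (hΛ : 0 < Λ) (hα : 0 < α) :
    (α ≤ 1 →
      (∀ᵐ ω ∂P,
        logCapacity (((↑) : ℝ → ℂ) '' limsupIntervals (fun k => c k ω) (expLength Λ α)) =
          logCapacity (((↑) : ℝ → ℂ) '' Icc (0 : ℝ) 1)) ∧
      0 < logCapacity (((↑) : ℝ → ℂ) '' Icc (0 : ℝ) 1)) ∧
    (1 < α → ∀ ω,
      logCapacity (((↑) : ℝ → ℂ) '' limsupIntervals (fun k => c k ω) (expLength Λ α)) = 0) := by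
  refine ⟨fun hα1 => ⟨?_, logCapacity_Icc_pos⟩,
    fun hα1 ω => logCapacity_limsupIntervals_eq_zero hΛ hα1 _⟩
  obtain ⟨A, hA, hl⟩ := exists_half_pow_lt_expLength hΛ hα1 hα
  have hmem : ∀ᵐ ω ∂P, ∀ k, c k ω ∈ Icc (0 : ℝ) 1 := by
    refine ae_all_iff.2 fun k => ?_
    refine (ae_map_iff (hc_meas k).aemeasurable (p := fun x => x ∈ Icc (0 : ℝ) 1)
      measurableSet_Icc).1 ?_
    rw [hc_law k]
    exact (withDensity_absolutelyContinuous _ _).ae_le (ae_restrict_mem measurableSet_Icc)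
  have hstep : ∀ᵐ ω ∂P, ∀ q : ℚ, ∀ h ∈ (stepDensity : Set (ℝ → ℝ≥0∞)),
      densityEnergy h < ENNReal.ofReal q * (∫⁻ x, h x) ^ 2 →
      ∀ n : ℕ, ∃ u ∈ stepDensity, densityEnergy u < ENNReal.ofReal q * (∫⁻ x, u x) ^ 2 ∧
      (∀ x, u x ≠ 0 → h x ≠ 0) ∧ closure {x | u x ≠ 0} ⊆
        ⋃ k ≥ n, Ioo (c k ω - expLength Λ α k / 2) (c k ω + expLength Λ α k / 2) := by
    -- Both quantifiers range over countable sets, and the energy hypothesis does not depend on `ω`.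
    refine ae_all_iff.2 fun q => (ae_ball_iff countable_stepDensity).2 fun h hh => ?_
    by_cases hlt : densityEnergy h < ENNReal.ofReal q * (∫⁻ x, h x) ^ 2
    · filter_upwards [ae_exists_stepDensity hc_meas hc_indep hf_meas hf_pos hc_law hA hl hh
        ENNReal.ofReal_ne_top hlt] with ω hω _ using hω
    · exact Filter.Eventually.of_forall fun ω h' => absurd h' hlt
  filter_upwards [hmem, hstep] with ω h1 h2
  refine le_antisymm (logCapacity_mono (image_mono ?_)) (logCapacity_Icc_le_limsupIntervals h2)
  exact limsupIntervals_subset_Icc h1 (tendsto_expLength hΛ hα)
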